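/- Let $n\ge 1$, let $\Omega\subset\mathbb R^n$ be a bounded domain with smooth boundary, and let $B\subset\mathbb R^n$ be the open unit ball with boundary $S$, surface measure $ds$ and outer normal $\nu$. Let $\Psi(x,y)\in\mathbb R^n$ be given for $x\in\Omega$, $y\in\overline B$, and put $\Phi(x,y)=(x,\Psi(x,y))$, $\Omega_x=\Psi(x,B)$ and $Q=\Phi(\Omega\times B)=\bigcup_{x\in\Omega}\{x\}\times\Omega_x$. Assume: * $\Phi:\Omega\times B\to Q$ is bijective, and $\Phi$ and $\Phi^{-1}$ are Lipschitz continuous; * for every $x\in\Omega$, $\Psi(x,\cdot)$ is a $C^\infty$-diffeomorphism from $\overline B$ onto $\overline{\Omega_x}$ that maps $S$ onto $\partial\Omega_x$; * the derivatives of order at most two of $\Psi(x,\cdot)$ and of its inverse are bounded in $L_2(B)$ and in $L_2(\Omega_x)$, respectively, uniformly in $x\in\Omega$. For real functions $U$ on $Q$ write $\Phi^*U=U\circ\Phi$, and for real functions $V$ on $\Omega\times B$ write $\Phi_*V=V\circ\Phi^{-1}$. Let $g_{ij}(x)=(\partial_{y_i}\Psi(x,\cdot)\,|\,\partial_{y_j}\Psi(x,\cdot))$,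 $|g|=\det(g_{ij})$, $(g^{ij})=(g_{ij})^{-1}$ and $$\mathcal A_x v=-\frac1{\sqrt{|g(x)|}}\sum_{i,j}\partial_{y_i}\Bigl(\sqrt{|g(x)|}\,g^{ij}(x)\,\partial_{y_j}v\Bigr),\qquad v\in W_2^2(B),$$ $$q(U)(x)=-\int_S\sum_{i,j}\sqrt{|g(x)|}\,g^{ij}(x)\,\partial_{y_i}V(x)\,\nu_j\,ds,\qquad V=\Phi^*U .$$ Let $L_2(\Omega,W_2^2(\Omega_x))=\Phi_*\bigl(L_2(\Omega,W_2^2(B))\bigr)$, let $W_2^{1,0}(\Omega)$ be the closure of $C_c^\infty(\Omega)$ in $W_2^1(\Omega)$, and let $\operatorname{dom}(\mathbf A_q)$ be the set of all $(u,U)$ with $u\in W_2^2(\Omega)\cap W_2^{1,0}(\Omega)$ and $U\in L_2(\Omega,W_2^2(\Omega_x))$ such that for a.e. $x\in\Omega$ the trace of $(\Phi^*U)(x,\cdot)$ on $S$ is the constant $u(x)$. For $(u,U)\in\operatorname{dom}(\mathbf A_q)$ let $$\mathbf A_q(u,U)=\bigl(-\Delta u-q(U),\ \Phi_*[\mathcal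 A_x\,\Phi^*U(x,\cdot)]\bigr),$$ and let $$((u,U),(w,W))_{Y_g}=\int_\Omega u\,w\,dx+\int_\Omega\int_B\sqrt{|g|}\;\Phi^*U\;\Phi^*W\,dy\,dx$$ be the inner product of $Y_g=L_2(\Omega)\times L_2(\Omega,L_2(\Omega_x,\sqrt{|g|}))$. Then there is a constant $\sigma>0$ (depending only on $\Omega$ and $\Phi$) such that for all $(u,U)\in\operatorname{dom}(\mathbf A_q)$ the integrals in $(\mathbf A_q(u,U),(u,U))_{Y_g}$ and in $((u,U),(u,U))_{Y_g}$ (in the second term, the integral over $B$ for a.e. $x$ and then the integral over $\Omega$) converge absolutely, and $$(-\mathbf A_q(u,U),(u,U))_{Y_g}\le-\sigma\,((u,U),(u,U))_{Y_g}.$$ In other words, $-\mathbf A_q$ is uniformly dissipative. -/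

import Mathlib

open scoped ContDiff NNReal ENNReal Topology

noncomputable section

namespace MatchedMicro

open MeasureTheory Metric Filter

/-- `ℝⁿ` with the Euclidean norm. -/
abbrev Eu (n : ℕ) := EuclideanSpace ℝ (Fin n)

variable {n : ℕ}

/-- The open unit ball `B`. -/
def unitBall (n : ℕ) : Set (Eu n) := ball 0 1

/-- The closed unit ball. -/
def closedUnitBall (n : ℕ) : Set (Eu n) := closedBall 0 1

/-- The unit sphere `S = ∂B`. -/
abbrev UnitSphere (n : ℕ) := sphere (0 : Eu n) 1

/-- The surface measure `ds` of the unit sphere. -/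
def surface (n : ℕ) : Measure (UnitSphere n) := (volume : Measure (Eu n)).toSphere

/-- Classical partial derivative `∂ᵢ f`. -/
def partialDeriv (i : Fin n) (f : Eu n → ℝ) (y : Eu n) : ℝ :=
  fderiv ℝ f y (EuclideanSpace.single i 1)

/-! ### Sobolev spaces of order at most two, with exponent two -/

/-- Test functions on the open set `O`: smooth, with compact support contained in `O`. -/
def IsTest (O : Set (Eu n)) (φ : Eu n → ℝ) : Prop :=
  ContDiff ℝ ∞ φ ∧ HasCompactSupport φ ∧ tsupport φ ⊆ O

/-- `h` is a weak `i`-th partial derivative of `f` on the open set `O`. -/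
def HasWeakPartial (O : Set (Eu n)) (i : Fin n) (f h : Eu n → ℝ) : Prop :=
  LocallyIntegrableOn f O ∧ LocallyIntegrableOn h O ∧
    ∀ φ, IsTest O φ → ∫ y in O, f y * partialDeriv i φ y = -∫ y in O, h y * φ y

open Classical in
/-- The weak `i`-th partial derivative on `O`. It is determined up to a null set; a
representative is chosen. The value is zero if there is no weak derivative. -/
def weakPartial (O : Set (Eu n)) (i : Fin n) (f : Eu n → ℝ) : Eu n → ℝ :=
  if h : ∃ d, HasWeakPartial O i f d then h.choose else 0

/-- `f ∈ W₂¹(O)`. -/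
def MemW1 (O : Set (Eu n)) (f : Eu n → ℝ) : Prop :=
  MemLp f 2 (volume.restrict O) ∧
    ∀ i, ∃ d, HasWeakPartial O i f d ∧ MemLp d 2 (volume.restrict O)

/-- `f ∈ W₂²(O)`. -/
def MemW2 (O : Set (Eu n)) (f : Eu n → ℝ) : Prop :=
  MemLp f 2 (volume.restrict O) ∧ ∀ i, ∃ d, HasWeakPartial O i f d ∧ MemW1 O d

/-- The sequence `φ` of smooth functions converges to `f` in the norm of `W₂¹(O)`. -/
def TendstoW1 (O : Set (Eu n)) (φ : ℕ → Eu n → ℝ) (f : Eu n → ℝ) : Prop :=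
  Tendsto (fun k => eLpNorm (fun y => φ k y - f y) 2 (volume.restrict O)) atTop (𝓝 0) ∧
    ∀ i, Tendsto (fun k => eLpNorm (fun y => partialDeriv i (φ k) y - weakPartial O i f y) 2
      (volume.restrict O)) atTop (𝓝 0)

/-- `f ∈ W₂^{1,0}(O)`, the closure of the test functions in `W₂¹(O)`. -/
def MemW10 (O : Set (Eu n)) (f : Eu n → ℝ) : Prop :=
  MemW1 O f ∧ ∃ φ : ℕ → Eu n → ℝ, (∀ k, IsTest O (φ k)) ∧ TendstoW1 O φ f

/-- The Laplace operator on `W₂²(O)`. -/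
def weakLaplacian (O : Set (Eu n)) (f : Eu n → ℝ) (x : Eu n) : ℝ :=
  ∑ i, weakPartial O i (weakPartial O i f) x

/-- `τ ∈ L₂(S)` is the trace of `v ∈ W₂¹(B)` on the unit sphere: the trace operator is the
continuous extension to `W₂¹(B)` of the restriction to `S` of functions smooth up to `S`. -/
def IsSphereTrace (v : Eu n → ℝ) (τ : UnitSphere n → ℝ) : Prop :=
  MemW1 (unitBall n) v ∧ MemLp τ 2 (surface n) ∧
    ∃ φ : ℕ → Eu n → ℝ, (∀ k, ContDiff ℝ ∞ (φ k)) ∧ TendstoW1 (unitBall n) φ v ∧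
      Tendsto (fun k => eLpNorm (fun s : UnitSphere n => φ k s - τ s) 2 (surface n)) atTop (𝓝 0)

open Classical in
/-- The trace operator `W₂¹(B) → L₂(S)` (a representative is chosen). -/
def sphereTrace (v : Eu n → ℝ) : UnitSphere n → ℝ :=
  if h : ∃ τ, IsSphereTrace v τ then h.choose else 0

/-! ### Geometry -/

/-- A bounded domain with smooth boundary: near each boundary point the domain is the sublevel set
of a smooth function with nonvanishing derivative. -/
structure IsSmoothBoundedDomain (Ω : Set (Eu n)) : Prop where
  isOpen : IsOpen Ω
  isConnected : IsConnected Ω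
  isBounded : Bornology.IsBounded Ω
  smooth_boundary : ∀ x₀ ∈ frontier Ω, ∃ N : Set (Eu n), IsOpen N ∧ x₀ ∈ N ∧
    ∃ ρ : Eu n → ℝ, ContDiff ℝ ∞ ρ ∧ fderiv ℝ ρ x₀ ≠ 0 ∧ Ω ∩ N = {x ∈ N | ρ x < 0}

/-- The map `Φ(x, y) = (x, Ψ(x, y))`. -/
def cellMap (Ψ : Eu n → Eu n → Eu n) (p : Eu n × Eu n) : Eu n × Eu n := (p.1, Ψ p.1 p.2)

/-- The cell `Ω_x = Ψ(x, B)`. -/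
def cell (Ψ : Eu n → Eu n → Eu n) (x : Eu n) : Set (Eu n) := Ψ x '' unitBall n

/-- The two-scale domain `Q = ⋃ₓ {x} × Ω_x = Φ(Ω × B)`. -/
def twoScale (Ω : Set (Eu n)) (Ψ : Eu n → Eu n → Eu n) : Set (Eu n × Eu n) :=
  {p | p.1 ∈ Ω ∧ p.2 ∈ cell Ψ p.1}

/-- The inverse of `Ψ(x, ·)`, from the closure of the cell to the closed unit ball. -/
def cellInv (Ψ : Eu n → Eu n → Eu n) (x : Eu n) : Eu n → Eu n :=
  Function.invFunOn (Ψ x) (closedUnitBall n)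

/-- `ψ` is a smooth diffeomorphism from the closed unit ball onto the closure of `ψ(B)`, mapping
the sphere onto the boundary of `ψ(B)`. -/
structure IsCellDiffeo (ψ : Eu n → Eu n) : Prop where
  contDiffOn : ContDiffOn ℝ ∞ ψ (closedUnitBall n)
  injOn : Set.InjOn ψ (closedUnitBall n)
  image_closedBall : ψ '' closedUnitBall n = closure (ψ '' unitBall n)
  image_sphere : ψ '' sphere 0 1 = frontier (ψ '' unitBall n)
  contDiffOn_inv : ContDiffOn ℝ ∞ (Function.invFunOn ψ (closedUnitBall n))
    (closure (ψ '' unitBall n))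

/-- The standing assumptions on `Φ`: it is bi-Lipschitz from `Ω × B` onto `Q`; every `Φ(x, ·)` is a
diffeomorphism of the closures; and the derivatives up to order two of `Φ(x, ·)` and of its inverse
are bounded in `L₂`, uniformly in `x`. (The component `x` of `Φ(x, ·)` is constant, and bounded
because `Ω` is, so that only `Ψ(x, ·)` and its inverse enter in `sobolev_bound`.) -/
structure IsCellGeometry (Ω : Set (Eu n)) (Ψ : Eu n → Eu n → Eu n) : Prop where
  lipschitz : ∃ K : ℝ≥0, LipschitzOnWith K (cellMap Ψ) (Ω ×ˢ unitBall n)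
  injOn : Set.InjOn (cellMap Ψ) (Ω ×ˢ unitBall n)
  lipschitz_inv : ∃ K : ℝ≥0, LipschitzOnWith K
    (Function.invFunOn (cellMap Ψ) (Ω ×ˢ unitBall n)) (twoScale Ω Ψ)
  diffeo : ∀ x ∈ Ω, IsCellDiffeo (Ψ x)
  sobolev_bound : ∃ C : ℝ≥0, ∀ x ∈ Ω, ∀ k ≤ 2,
    eLpNorm (iteratedFDeriv ℝ k (Ψ x)) 2 (volume.restrict (unitBall n)) ≤ C ∧
    eLpNorm (iteratedFDeriv ℝ k (cellInv Ψ x)) 2 (volume.restrict (cell Ψ x)) ≤ C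

/-- Pull back `Φ^* U = U ∘ Φ`, as a function of `x` and `y`. -/
def pullBack (Ψ : Eu n → Eu n → Eu n) (U : Eu n × Eu n → ℝ) (x y : Eu n) : ℝ :=
  U (cellMap Ψ (x, y))

/-- Push forward `Φ_* V = V ∘ Φ⁻¹`. -/
def pushForward (Ψ : Eu n → Eu n → Eu n) (V : Eu n → Eu n → ℝ) (p : Eu n × Eu n) : ℝ :=
  V p.1 (cellInv Ψ p.1 p.2)

/-! ### The metric and the operators -/

/-- `∂_{yᵢ} Ψ(x, y)`, for `y` in the closed unit ball. -/
def cellPartial (Ψ : Eu n → Eu n → Eu n) (x : Eu n) (i : Fin n) (y : Eu n) : Eu n :=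
  fderivWithin ℝ (Ψ x) (closedUnitBall n) y (EuclideanSpace.single i 1)

/-- The metric `g_{ij}(x) = (∂ᵢ Φ(x) | ∂ⱼ Φ(x)) = (∂ᵢ Ψ(x) | ∂ⱼ Ψ(x))`. -/
def metric (Ψ : Eu n → Eu n → Eu n) (x y : Eu n) : Matrix (Fin n) (Fin n) ℝ :=
  Matrix.of fun i j => inner ℝ (cellPartial Ψ x i y) (cellPartial Ψ x j y)

/-- `√|g(x)|`. -/
def sqrtDet (Ψ : Eu n → Eu n → Eu n) (x y : Eu n) : ℝ := Real.sqrt (metric Ψ x y).det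

/-- `√|g(x)| g^{ij}(x)`, with `(g^{ij})` the inverse matrix of `(g_{ij})`. -/
def coeff (Ψ : Eu n → Eu n → Eu n) (x : Eu n) (i j : Fin n) (y : Eu n) : ℝ :=
  sqrtDet Ψ x y * (metric Ψ x y)⁻¹ i j

/-- The Laplace-Beltrami operator
`𝒜_x v = -(1 / √|g|) ∑_{i,j} ∂ᵢ (√|g| g^{ij} ∂ⱼ v)` for `v ∈ W₂²(B)`. -/
def laplaceBeltrami (Ψ : Eu n → Eu n → Eu n) (x : Eu n) (v : Eu n → ℝ) (y : Eu n) : ℝ :=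
  -(1 / sqrtDet Ψ x y) * ∑ i, ∑ j,
    weakPartial (unitBall n) i
      (fun y' => coeff Ψ x i j y' * weakPartial (unitBall n) j v y') y

/-- The exchange term
`q(U)(x) = -∫_S ∑_{i,j} √|g| g^{ij} ∂ᵢ V(x) νⱼ ds` with `V = Φ^* U`; the outer normal at `s` is `s`,
and `∂ᵢ V(x)` on `S` is the trace of the weak derivative. -/
def exchange (Ψ : Eu n → Eu n → Eu n) (U : Eu n × Eu n → ℝ) (x : Eu n) : ℝ :=
  -∫ s : UnitSphere n, ∑ i, ∑ j, coeff Ψ x i j s *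
    sphereTrace (weakPartial (unitBall n) i (pullBack Ψ U x)) s * (s : Eu n) j ∂(surface n)

/-- `V ∈ L₂(Ω, W₂²(B))`: as `W₂²(B)` is isometric to the closed subspace of all `(v, ∂v, ∂²v)` in
a power of `L₂(B)`, and `L₂(Ω, L₂(B)) = L₂(Ω × B)`, this says that `V` and its weak derivatives in
`y` up to order two are given by elements of `L₂(Ω × B)`. -/
def MemL2W2 (Ω : Set (Eu n)) (V : Eu n → Eu n → ℝ) : Prop :=
  ∃ (D : Fin n → Eu n × Eu n → ℝ) (H : Fin n → Fin n → Eu n × Eu n → ℝ),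
    MemLp (Function.uncurry V) 2 ((volume.restrict Ω).prod (volume.restrict (unitBall n))) ∧
    (∀ i, MemLp (D i) 2 ((volume.restrict Ω).prod (volume.restrict (unitBall n)))) ∧
    (∀ i j, MemLp (H i j) 2 ((volume.restrict Ω).prod (volume.restrict (unitBall n)))) ∧
    ∀ᵐ x ∂(volume.restrict Ω), ∀ i,
      HasWeakPartial (unitBall n) i (V x) (fun y => D i (x, y)) ∧
      ∀ j, HasWeakPartial (unitBall n) j (fun y => D i (x, y)) (fun y => H i j (x, y))

/-- Pairs `(u, U)` of a function on `Ω` and a function on `Q` (values outside are irrelevant). -/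
abbrev FunPair (n : ℕ) := (Eu n → ℝ) × (Eu n × Eu n → ℝ)

/-- `(u, U) ∈ dom(A) = dom(A_q)`: `u ∈ W₂²(Ω) ∩ W₂^{1,0}(Ω)`, `U ∈ L₂(Ω, W₂²(Ω_x))`, `tr U = u`. -/
structure MemDom (Ω : Set (Eu n)) (Ψ : Eu n → Eu n → Eu n) (w : FunPair n) : Prop where
  memW2 : MemW2 Ω w.1
  memW10 : MemW10 Ω w.1
  memL2W2 : MemL2W2 Ω (pullBack Ψ w.2)
  trace_eq : ∀ᵐ x ∂(volume.restrict Ω), IsSphereTrace (pullBack Ψ w.2 x) (fun _ => w.1 x)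

/-- `A(u, U) = (-Δ_x u, Φ_* [𝒜_x Φ^* U])`. -/
def opA (Ω : Set (Eu n)) (Ψ : Eu n → Eu n → Eu n) (w : FunPair n) : FunPair n :=
  (fun x => -weakLaplacian Ω w.1 x,
    pushForward Ψ (fun x y => laplaceBeltrami Ψ x (pullBack Ψ w.2 x) y))

/-- `A_q(u, U) = A(u, U) - (q(U), 0)`. -/
def opAq (Ω : Set (Eu n)) (Ψ : Eu n → Eu n → Eu n) (w : FunPair n) : FunPair n :=
  opA Ω Ψ w - (exchange Ψ w.2, 0)

/-- The inner product of `Y_g = L₂(Ω) × L₂(Ω, L₂(Ω_x, √|g|))`,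
`((u, U), (w, W)) = ∫_Ω u w + ∫_Ω ∫_B √|g| Φ^* U Φ^* W`. -/
def innerYg (Ω : Set (Eu n)) (Ψ : Eu n → Eu n → Eu n) (w w' : FunPair n) : ℝ :=
  (∫ x in Ω, w.1 x * w'.1 x) +
    ∫ x in Ω, ∫ y in unitBall n, sqrtDet Ψ x y * (pullBack Ψ w.2 x y * pullBack Ψ w'.2 x y)

/-- All the integrals in the inner product of `Y_g` converge absolutely. -/
structure InnerYgExists (Ω : Set (Eu n)) (Ψ : Eu n → Eu n → Eu n) (w w' : FunPair n) : Prop where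
  macro_integrable : IntegrableOn (fun x => w.1 x * w'.1 x) Ω
  cell_integrable : ∀ᵐ x ∂(volume.restrict Ω), IntegrableOn
    (fun y => sqrtDet Ψ x y * (pullBack Ψ w.2 x y * pullBack Ψ w'.2 x y)) (unitBall n)
  micro_integrable : IntegrableOn (fun x => ∫ y in unitBall n,
    sqrtDet Ψ x y * (pullBack Ψ w.2 x y * pullBack Ψ w'.2 x y)) Ω

end MatchedMicro

end

/-!
Write `V = Φ^* U`. Testing `-A_q (u, U)` with `(u, U)` and integrating by parts on both scales gives
`-∫_Ω |∇u|² + ∫_Ω q(U) u` from the first component and, on each cell, minus the energy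
`∫_B ∑ √|g| g^{ij} ∂ᵢV ∂ⱼV` plus a boundary integral from the second. As the trace of `V(x, ·)` is
the constant `u(x)`, that boundary integral is `u(x)` times the flux through the sphere, which is
`-q(U)(x)`. So the exchange terms cancel, and only the two energies remain (`innerYg_neg_opAq`).

The energies control the norm of `Y_g`. Poincaré's inequality on `W₂^{1,0}(Ω)`
(`MemW10.integral_sq_le`) bounds `∫ u²` by `∫ |∇u|²`; Poincaré's inequality with a boundary term on
the ball (`IsSphereTrace.integral_unitBall_sq_le`) bounds `∫_B V²` by the square of the trace `u(x)`
and by the gradient; and the gradient is bounded by the energy, because the two Lipschitz conditions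
make the metric uniformly elliptic and bounded (`IsCellGeometry.exists_coeffBounds`).

The cell computation rests on the divergence theorem for the ball. For functions smooth up to the
sphere it is proved by integrating the divergence against radial cutoff functions, which converge to
the indicator function of the ball, in polar coordinates (`integral_unitBall_partialDeriv`); it
passes to `W₂¹(B)` by the definition of the trace (`IsSphereTrace.integral_mul`). The exchange term
contains the traces of the derivatives of `V`, so the existence of traces is needed. It follows from
the density of smooth functions in `W₂¹(B)`, obtained by dilating and mollifying
(`MemW1.exists_tendstoW1`), and from the trace inequality (`IsSphereTrace.integral_sq_le`).

The integrals over `Ω` exist because all quantities are jointly measurable. The metric is measurable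
because `Ψ` extends to a function that is Lipschitz in both variables, the derivatives of the
coefficients are limits of difference quotients, and the flux is measurable and integrable because
the divergence theorem turns it into an integral over the ball (`flux_eq_integral`,
`abs_mul_flux_le`).
-/

namespace MatchedMicro

open MeasureTheory Metric Filter

variable {n : ℕ}
/-! ### Convergence in `L₂` -/

section LTwo

variable {α : Type*} [MeasurableSpace α] {μ : Measure α}

/-- Products of `L₂`-convergent sequences converge in mean. -/
theorem tendsto_integral_mul_of_tendsto_eLpNorm {f g : ℕ → α → ℝ} {F G : α → ℝ}
    (hf : ∀ k, MemLp (f k) 2 μ) (hF : MemLp F 2 μ) (hg : ∀ k, MemLp (g k) 2 μ)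
    (hG : MemLp G 2 μ)
    (hfF : Tendsto (fun k => eLpNorm (fun y => f k y - F y) 2 μ) atTop (𝓝 0))
    (hgG : Tendsto (fun k => eLpNorm (fun y => g k y - G y) 2 μ) atTop (𝓝 0)) :
    Tendsto (fun k => ∫ y, f k y * g k y ∂μ) atTop (𝓝 (∫ y, F y * G y ∂μ)) := by
  have inner_toLp : ∀ {f g : α → ℝ} (hf : MemLp f 2 μ) (hg : MemLp g 2 μ),
      inner ℝ (hg.toLp g) (hf.toLp f) = ∫ y, f y * g y ∂μ := by
    intro f g hf hg
    rw [L2.inner_def]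
    refine integral_congr_ae ?_
    filter_upwards [hf.coeFn_toLp, hg.coeFn_toLp] with y h1 h2
    simp [h1, h2]
  have h1 := (Lp.tendsto_Lp_iff_tendsto_eLpNorm'' f hf F hF).2 hfF
  have h2 := (Lp.tendsto_Lp_iff_tendsto_eLpNorm'' g hg G hG).2 hgG
  simpa only [inner_toLp] using h2.inner (𝕜 := ℝ) h1

theorem tendsto_integral_mul_left {f : ℕ → α → ℝ} {F G : α → ℝ}
    (hf : ∀ k, MemLp (f k) 2 μ) (hF : MemLp F 2 μ) (hG : MemLp G 2 μ)
    (hfF : Tendsto (fun k => eLpNorm (fun y => f k y - F y) 2 μ) atTop (𝓝 0)) :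
    Tendsto (fun k => ∫ y, f k y * G y ∂μ) atTop (𝓝 (∫ y, F y * G y ∂μ)) :=
  tendsto_integral_mul_of_tendsto_eLpNorm hf hF (fun _ => hG) hG hfF (by simp)

theorem tendsto_integral_sq {f : ℕ → α → ℝ} {F : α → ℝ}
    (hf : ∀ k, MemLp (f k) 2 μ) (hF : MemLp F 2 μ)
    (hfF : Tendsto (fun k => eLpNorm (fun y => f k y - F y) 2 μ) atTop (𝓝 0)) :
    Tendsto (fun k => ∫ y, f k y ^ 2 ∂μ) atTop (𝓝 (∫ y, F y ^ 2 ∂μ)) := by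
  simpa only [sq] using tendsto_integral_mul_of_tendsto_eLpNorm hf hF hf hF hfF hfF

theorem eLpNorm_two_eq_ofReal_sqrt {f : α → ℝ} (hf : MemLp f 2 μ) :
    eLpNorm f 2 μ = ENNReal.ofReal (Real.sqrt (∫ y, f y ^ 2 ∂μ)) := by
  rw [hf.eLpNorm_eq_integral_rpow_norm (by simp) (by simp)]
  simp [Real.sqrt_eq_rpow]

/-- A sequence in `L₂` that is Cauchy in mean square converges in mean square. -/
theorem exists_tendsto_eLpNorm_of_cauchy {f : ℕ → α → ℝ} (hf : ∀ k, MemLp (f k) 2 μ)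
    (hc : ∀ ε : ℝ, 0 < ε → ∃ N, ∀ k ≥ N, ∀ l ≥ N, ∫ y, (f k y - f l y) ^ 2 ∂μ < ε) :
    ∃ F, MemLp F 2 μ ∧
      Tendsto (fun k => eLpNorm (fun y => f k y - F y) 2 μ) atTop (𝓝 0) := by
  have hcau : CauchySeq fun k => (hf k).toLp (f k) := by
    refine Metric.cauchySeq_iff.2 fun ε hε => ?_
    obtain ⟨N, hN⟩ := hc (ε ^ 2) (by positivity)
    refine ⟨N, fun k hk l hl => ?_⟩
    rw [dist_eq_norm, ← MemLp.toLp_sub, Lp.norm_toLp,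
      eLpNorm_two_eq_ofReal_sqrt ((hf k).sub (hf l)), ENNReal.toReal_ofReal (Real.sqrt_nonneg _),
      Real.sqrt_lt' hε]
    exact hN k hk l hl
  obtain ⟨F, hF⟩ := cauchySeq_tendsto_of_complete hcau
  refine ⟨F, Lp.memLp F, ?_⟩
  have h : (Lp.memLp F).toLp F = F := Lp.toLp_coeFn F (Lp.memLp F)
  rw [← h] at hF
  exact (Lp.tendsto_Lp_iff_tendsto_eLpNorm'' f hf F (Lp.memLp F)).1 hF

end LTwo

/-! ### The divergence theorem on the unit ball -/

theorem finrank_eu : Module.finrank ℝ (Eu n) = n := by simp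

instance : IsFiniteMeasure (surface n) := by unfold surface; infer_instance

theorem nontrivial_eu (hn : 1 ≤ n) : Nontrivial (Eu n) :=
  Module.nontrivial_of_finrank_pos (R := ℝ) (by rw [finrank_eu]; omega)

/-- Integration in polar coordinates. -/
theorem integral_eq_integral_polar (hn : 1 ≤ n) {G : Eu n → ℝ} (hG : Integrable G) :
    ∫ y, G y = ∫ r in Set.Ioi (0 : ℝ), r ^ (n - 1) * ∫ s : UnitSphere n, G (r • (s : Eu n))
      ∂(surface n) := by
  have := nontrivial_eu hn
  have hmp := (volume : Measure (Eu n)).measurePreserving_homeomorphUnitSphereProd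
  rw [finrank_eu] at hmp
  set μ' : Measure (UnitSphere n × Set.Ioi (0 : ℝ)) :=
    ((volume : Measure (Eu n)).toSphere.prod (Measure.volumeIoiPow (n - 1)))
  have hemb := (homeomorphUnitSphereProd (Eu n)).measurableEmbedding
  have key : ∀ y : ({(0)}ᶜ : Set (Eu n)),
      (fun p : UnitSphere n × Set.Ioi (0 : ℝ) => G ((p.2 : ℝ) • (p.1 : Eu n)))
        (homeomorphUnitSphereProd (Eu n) y) = G y := by
    intro y
    have h := congrArg Subtype.val ((homeomorphUnitSphereProd (Eu n)).symm_apply_apply y)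
    rw [homeomorphUnitSphereProd_symm_apply_coe] at h
    simp only [h]
  have hint : Integrable (fun p : UnitSphere n × Set.Ioi (0 : ℝ) =>
      G ((p.2 : ℝ) • (p.1 : Eu n))) μ' := by
    rw [← hmp.integrable_comp_emb hemb]
    have h1 : IntegrableOn G ({0}ᶜ : Set (Eu n)) := hG.integrableOn
    rw [integrableOn_iff_comap_subtypeVal (by measurability)] at h1
    refine h1.congr (Eventually.of_forall fun y => ?_)
    exact (key y).symm
  have h2 : ∫ y, G y = ∫ p, G ((p.2 : ℝ) • (p.1 : Eu n)) ∂μ' := by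
    rw [← hmp.integral_comp hemb]
    simp_rw [key]
    rw [integral_subtype_comap (measurableSet_singleton _).compl G, restrict_compl_singleton]
  rw [h2, integral_prod_symm _ hint]
  simp only [Measure.volumeIoiPow, ENNReal.ofReal]
  rw [integral_withDensity_eq_integral_smul (by fun_prop),
    integral_subtype_comap measurableSet_Ioi fun r : ℝ => Real.toNNReal (r ^ (n - 1)) •
      ∫ s : UnitSphere n, G (r • (s : Eu n)) ∂(volume : Measure (Eu n)).toSphere]
  refine setIntegral_congr_fun measurableSet_Ioi fun r hr => ?_
  simp only [NNReal.smul_def, Real.coe_toNNReal _ (pow_nonneg (le_of_lt (Set.mem_Ioi.1 hr)) _),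
    smul_eq_mul, surface]

/-- The Lipschitz cutoff function that is `1` on the ball of radius `1 - ε`, vanishes outside the
unit ball, and is linear in the radius in between. -/
noncomputable def ballCutoff (ε : ℝ) (y : Eu n) : ℝ := min 1 (max 0 ((1 - ‖y‖) / ε))

theorem lipschitzWith_ballCutoff {ε : ℝ} (hε : 0 < ε) :
    LipschitzWith (Real.toNNReal ε⁻¹) (ballCutoff ε : Eu n → ℝ) := by
  have h : LipschitzWith (Real.toNNReal ε⁻¹) fun y : Eu n => (1 - ‖y‖) / ε := by
    refine LipschitzWith.of_dist_le_mul fun x y => ?_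
    rw [Real.coe_toNNReal _ (by positivity), Real.dist_eq, ← sub_div, abs_div, abs_of_pos hε,
      div_eq_inv_mul, dist_eq_norm, sub_sub_sub_cancel_left, abs_sub_comm]
    gcongr
    exact abs_norm_sub_norm_le x y
  exact (h.const_max 0).const_min 1

theorem ballCutoff_eq_zero {ε : ℝ} (hε : 0 < ε) {y : Eu n} (hy : 1 ≤ ‖y‖) :
    ballCutoff ε y = 0 := by
  have : (1 - ‖y‖) / ε ≤ 0 := div_nonpos_of_nonpos_of_nonneg (by linarith) hε.le
  simp [ballCutoff, max_eq_left this]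

theorem ballCutoff_eq_one {ε : ℝ} (hε : 0 < ε) {y : Eu n} (hy : ‖y‖ ≤ 1 - ε) :
    ballCutoff ε y = 1 := by
  have : 1 ≤ (1 - ‖y‖) / ε := by rw [le_div_iff₀ hε]; linarith
  simp only [ballCutoff]
  rw [max_eq_right (by linarith), min_eq_left this]

theorem abs_ballCutoff_le (ε : ℝ) (y : Eu n) : |ballCutoff ε y| ≤ 1 := by
  rw [abs_of_nonneg (le_min zero_le_one (le_max_left _ _))]
  exact min_le_left _ _

theorem hasCompactSupport_ballCutoff {ε : ℝ} (hε : 0 < ε) :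
    HasCompactSupport (ballCutoff ε : Eu n → ℝ) := by
  refine HasCompactSupport.intro (isCompact_closedBall (0 : Eu n) 1) fun y hy => ?_
  refine ballCutoff_eq_zero hε ?_
  simp only [mem_closedBall, dist_zero_right, not_le] at hy
  exact hy.le

theorem hasDerivAt_norm_add_smul {y : Eu n} (hy : y ≠ 0) (v : Eu n) :
    HasDerivAt (fun t : ℝ => ‖y + t • v‖) (inner ℝ y v / ‖y‖) 0 := by
  have h1 : HasDerivAt (fun t : ℝ => y + t • v) v 0 := by
    simpa using ((hasDerivAt_id (0 : ℝ)).smul_const v).const_add y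
  have h2 := h1.norm_sq
  have h3 := h2.sqrt (by simpa using hy)
  simp only [Real.sqrt_sq (norm_nonneg _), zero_smul, add_zero] at h3
  convert h3 using 1
  field_simp

theorem lineDeriv_ballCutoff {ε : ℝ} (hε : 0 < ε) (hε1 : ε < 1) {y : Eu n}
    (h1 : ‖y‖ ≠ 1) (h2 : ‖y‖ ≠ 1 - ε) (i : Fin n) :
    lineDeriv ℝ (ballCutoff ε) y (-EuclideanSpace.single i 1) =
      (Set.Ioo (1 - ε) 1).indicator (fun _ => ε⁻¹) ‖y‖ * (y i / ‖y‖) := by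
  rcases lt_or_gt_of_ne h2 with h2 | h2
  · have he : ballCutoff ε =ᶠ[𝓝 y] fun _ => 1 := by
      filter_upwards [continuous_norm.continuousAt.eventually_lt_const h2] with z hz
      exact ballCutoff_eq_one hε hz.le
    rw [Filter.EventuallyEq.lineDeriv_eq he, Set.indicator_of_notMem (by simp [h2.le])]
    simp [lineDeriv]
  rcases lt_or_gt_of_ne h1 with h1 | h1
  · have he : ballCutoff ε =ᶠ[𝓝 y] fun z => (1 - ‖z‖) / ε := by
      filter_upwards [continuous_norm.continuousAt.eventually_lt_const h1,
        continuous_norm.continuousAt.eventually_const_lt h2] with z hz hz'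
      have hp : 0 ≤ (1 - ‖z‖) / ε := div_nonneg (by linarith) hε.le
      have hq : (1 - ‖z‖) / ε ≤ 1 := by rw [div_le_one hε]; linarith
      simp only [ballCutoff]
      rw [max_eq_right hp, min_eq_right hq]
    rw [Filter.EventuallyEq.lineDeriv_eq he, 
      Set.indicator_of_mem (show ‖y‖ ∈ Set.Ioo (1 - ε) 1 from ⟨h2, h1⟩)]
    have hy : y ≠ 0 := by
      rintro rfl
      simp at h2
      linarith
    have hd := ((hasDerivAt_norm_add_smul hy (-EuclideanSpace.single i 1)).const_sub 1).div_const ε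
    rw [lineDeriv, hd.deriv]
    simp [EuclideanSpace.inner_single_right]
    ring
  · have he : ballCutoff ε =ᶠ[𝓝 y] fun _ => 0 := by
      filter_upwards [continuous_norm.continuousAt.eventually_const_lt h1] with z hz
      exact ballCutoff_eq_zero hε hz.le
    rw [Filter.EventuallyEq.lineDeriv_eq he, Set.indicator_of_notMem (by simp [h1.le])]
    simp [lineDeriv]

theorem integral_lineDeriv_mul_ballCutoff (hn : 1 ≤ n) {F : Eu n → ℝ} {K : ℝ≥0}
    (hF : LipschitzWith K F) {ε : ℝ} (hε : 0 < ε) (hε1 : ε < 1) (i : Fin n) :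
    ∫ y, lineDeriv ℝ F y (EuclideanSpace.single i 1) * ballCutoff ε y =
      ε⁻¹ * ∫ r in (1 - ε)..1, r ^ (n - 1) *
        ∫ s : UnitSphere n, F (r • (s : Eu n)) * (s : Eu n) i ∂(surface n) := by
  have := nontrivial_eu hn
  rw [hF.integral_lineDeriv_mul_eq (lipschitzWith_ballCutoff hε) (hasCompactSupport_ballCutoff hε)]
  have hae : ∀ᵐ y : Eu n, lineDeriv ℝ (ballCutoff ε) y (-EuclideanSpace.single i 1) * F y =
      (Set.Ioo (1 - ε) 1).indicator (fun _ => ε⁻¹) ‖y‖ * (y i / ‖y‖) * F y := by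
    have n1 : ∀ r : ℝ, ∀ᵐ y : Eu n, ‖y‖ ≠ r := by
      intro r
      have h0 := Measure.addHaar_sphere (volume : Measure (Eu n)) 0 r
      filter_upwards [measure_eq_zero_iff_ae_notMem.1 h0] with y hy
      simpa using hy
    filter_upwards [n1 1, n1 (1 - ε)] with y h1 h2
    rw [lineDeriv_ballCutoff hε hε1 h1 h2]
  rw [integral_congr_ae hae, integral_eq_integral_polar hn]
  · rw [intervalIntegral.integral_of_le (by linarith), integral_Ioc_eq_integral_Ioo,
      ← integral_const_mul]
    have hsub : Set.Ioo (1 - ε) 1 ⊆ Set.Ioi 0 := fun r hr => lt_trans (by linarith) hr.1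
    rw [← integral_indicator measurableSet_Ioi, ← integral_indicator measurableSet_Ioo]
    congr 1
    ext r
    by_cases hr : r ∈ Set.Ioo (1 - ε) 1
    · have hr0 : 0 < r := hsub hr
      rw [Set.indicator_of_mem (show r ∈ Set.Ioi 0 from hr0), Set.indicator_of_mem hr,
        mul_left_comm, ← integral_const_mul ε⁻¹]
      refine congrArg (r ^ (n - 1) * ·) (integral_congr_ae (Eventually.of_forall fun s => ?_))
      have hs : ‖r • (s : Eu n)‖ = r := by
        rw [norm_smul, norm_eq_of_mem_sphere, mul_one, Real.norm_of_nonneg hr0.le]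
      simp only [hs, Set.indicator_of_mem hr, PiLp.smul_apply, smul_eq_mul]
      field_simp
    · rw [Set.indicator_of_notMem hr]
      by_cases hr0 : r ∈ Set.Ioi (0 : ℝ)
      · rw [Set.indicator_of_mem hr0]
        refine mul_eq_zero_of_right _ (integral_eq_zero_of_ae (Eventually.of_forall fun (s : UnitSphere n) => ?_))
        have hs : ‖r • (s : Eu n)‖ = r := by
          rw [norm_smul, norm_eq_of_mem_sphere, mul_one, Real.norm_of_nonneg (le_of_lt hr0)]
        simp [hs, Set.indicator_of_notMem hr]
      · rw [Set.indicator_of_notMem hr0]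
  · refine Integrable.congr ?_ hae
    obtain ⟨M, hM⟩ := (isCompact_closedBall (0 : Eu n) 1).exists_bound_of_continuousOn (f := F)
      hF.continuous.continuousOn
    have hi := ((lipschitzWith_ballCutoff (n := n) hε).memLp_lineDeriv (μ := volume)
      (-EuclideanSpace.single i (1 : ℝ) : Eu n)).restrict (closedBall 0 1)
    have hi' : IntegrableOn (fun y : Eu n => lineDeriv ℝ (ballCutoff ε) y
        (-EuclideanSpace.single i 1) * F y) (closedBall 0 1) := by
      refine Integrable.mul_bdd (c := M) ?_ hF.continuous.aestronglyMeasurable ?_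
      · have : IsFiniteMeasure ((volume : Measure (Eu n)).restrict (closedBall 0 1)) :=
          ⟨by simpa using measure_closedBall_lt_top⟩
        exact hi.integrable (by simp)
      · filter_upwards [ae_restrict_mem measurableSet_closedBall] with y hy using hM y hy
    rw [← integrableOn_univ]
    refine hi'.of_ae_sdiff_eq_zero MeasurableSet.univ.nullMeasurableSet ?_
    filter_upwards [hae] with y hy hy'
    rw [hy]
    have : 1 < ‖y‖ := by simpa using hy'
    simp [this.le]

/-- **Divergence theorem on the unit ball**, in coordinates, for functions that are Lipschitz
continuous on the closed ball. -/
theorem integral_unitBall_partialDeriv (hn : 1 ≤ n) {f : Eu n → ℝ} {K : ℝ≥0}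
    (hf : LipschitzOnWith K f (closedBall 0 1)) (hd : DifferentiableOn ℝ f (ball 0 1))
    (i : Fin n) :
    ∫ y in unitBall n, partialDeriv i f y =
      ∫ s : UnitSphere n, f s * (s : Eu n) i ∂(surface n) := by
  obtain ⟨F, hF, hfF⟩ := hf.extend_real
  set e : ℕ → ℝ := fun k => 1 / ((k : ℝ) + 2) with he
  have he0 : ∀ k, 0 < e k := fun k => by positivity
  have he1 : ∀ k, e k < 1 := fun k => by
    rw [he]; simp only; rw [div_lt_one (by positivity)]; linarith [k.cast_nonneg (α := ℝ)]
  have het : Tendsto e atTop (𝓝 0) := by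
    have := (tendsto_one_div_add_atTop_nhds_zero_nat (𝕜 := ℝ)).comp (tendsto_add_atTop_nat 1)
    refine this.congr fun k => ?_
    simp [he]; ring
  -- As the cutoff functions increase to the indicator function of the ball, the volume integrals
  -- converge by dominated convergence.
  have hL : Tendsto (fun k => ∫ y, lineDeriv ℝ F y (EuclideanSpace.single i 1) *
      ballCutoff (e k) y) atTop (𝓝 (∫ y in unitBall n, partialDeriv i f y)) := by
    rw [← integral_indicator (show MeasurableSet (unitBall n) from measurableSet_ball)]
    refine tendsto_integral_of_dominated_convergence
      ((unitBall n).indicator fun _ => (K : ℝ) * ‖(EuclideanSpace.single i (1 : ℝ) : Eu n)‖)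
      (fun k => ?_) ?_ (fun k => Eventually.of_forall fun y => ?_)
      (Eventually.of_forall fun y => ?_)
    · exact (aestronglyMeasurable_lineDeriv hF.continuous _).mul
        (lipschitzWith_ballCutoff (he0 k)).continuous.aestronglyMeasurable
    · rw [integrable_indicator_iff (show MeasurableSet (unitBall n) from measurableSet_ball)]
      exact integrableOn_const (hs := measure_ball_lt_top.ne)
    · by_cases hy : y ∈ unitBall n
      · rw [Set.indicator_of_mem hy, norm_mul]
        have h1 := norm_lineDeriv_le_of_lipschitz ℝ hF (x₀ := y)
          (v := (EuclideanSpace.single i (1 : ℝ) : Eu n))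
        calc _ ≤ ‖lineDeriv ℝ F y (EuclideanSpace.single i 1)‖ * 1 := by
              gcongr; exact abs_ballCutoff_le _ _
          _ ≤ _ := by simpa using h1
      · rw [Set.indicator_of_notMem hy]
        simp only [unitBall, mem_ball, dist_zero_right, not_lt] at hy
        simp [ballCutoff_eq_zero (he0 k) hy]
    · by_cases hy : y ∈ unitBall n
      · rw [Set.indicator_of_mem hy]
        have hy1 : ‖y‖ < 1 := by simpa [unitBall] using hy
        have hDF : lineDeriv ℝ F y (EuclideanSpace.single i 1) = partialDeriv i f y := by
          have heq : F =ᶠ[𝓝 y] f := by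
            filter_upwards [isOpen_ball.mem_nhds hy] with z hz
            exact (hfF (ball_subset_closedBall hz)).symm
          rw [Filter.EventuallyEq.lineDeriv_eq heq]
          exact ((hd y hy).differentiableAt (isOpen_ball.mem_nhds hy)).lineDeriv_eq_fderiv
        refine tendsto_const_nhds.congr' ?_
        filter_upwards [het.eventually_lt_const (show 0 < 1 - ‖y‖ by linarith)] with k hk
        rw [ballCutoff_eq_one (he0 k) (by linarith), hDF, mul_one]
      · rw [Set.indicator_of_notMem hy]
        simp only [unitBall, mem_ball, dist_zero_right, not_lt] at hy
        refine tendsto_const_nhds.congr fun k => ?_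
        rw [ballCutoff_eq_zero (he0 k) hy, mul_zero]
  -- The derivatives of the cutoff functions concentrate on the sphere.
  set φ : ℝ → ℝ := fun r => r ^ (n - 1) *
    ∫ s : UnitSphere n, F (r • (s : Eu n)) * (s : Eu n) i ∂(surface n) with hφ
  have hφc : Continuous φ := by
    refine (continuous_pow _).mul ?_
    refine continuous_parametric_integral_of_continuous (s := Set.univ) ?_ isCompact_univ |>.congr
      fun r => by rw [setIntegral_univ]
    have := hF.continuous
    fun_prop
  have hR : Tendsto (fun k => (e k)⁻¹ * ∫ r in (1 - e k)..1, φ r) atTop (𝓝 (φ 1)) := by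
    have hder : HasDerivAt (fun u => ∫ r in (1 : ℝ)..u, φ r) (φ 1) 1 :=
      intervalIntegral.integral_hasDerivAt_right (hφc.intervalIntegrable _ _)
        (hφc.stronglyMeasurableAtFilter _ _) hφc.continuousAt
    have hs := hder.tendsto_slope.comp (f := fun k => 1 - e k) (x := atTop) (by
      refine tendsto_nhdsWithin_iff.2 ⟨by simpa using het.const_sub 1, ?_⟩
      exact Eventually.of_forall fun k => by simpa using (he0 k).ne')
    refine hs.congr fun k => ?_
    simp only [Function.comp, slope_def_field, intervalIntegral.integral_same, sub_zero]
    rw [intervalIntegral.integral_symm]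
    rw [show 1 - e k - 1 = -e k by ring, neg_div_neg_eq, div_eq_inv_mul]
  have hφ1 : φ 1 = ∫ s : UnitSphere n, f s * (s : Eu n) i ∂(surface n) := by
    simp only [hφ, one_pow, one_mul, one_smul]
    refine integral_congr_ae (Eventually.of_forall fun (s : UnitSphere n) => ?_)
    simp only
    rw [hfF (sphere_subset_closedBall s.2)]
  rw [← hφ1]
  refine tendsto_nhds_unique hL (hR.congr fun k => ?_)
  rw [integral_lineDeriv_mul_ballCutoff hn hF (he0 k) (he1 k)]

/-! ### Weak derivatives -/

section Weak

variable {O : Set (Eu n)} {i : Fin n} {f g h d : Eu n → ℝ}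

theorem IsTest.continuous {φ : Eu n → ℝ} (hφ : IsTest O φ) : Continuous φ := hφ.1.continuous

theorem IsTest.eq_zero {φ : Eu n → ℝ} (hφ : IsTest O φ) {y : Eu n} (hy : y ∉ O) : φ y = 0 :=
  image_eq_zero_of_notMem_tsupport fun h => hy (hφ.2.2 h)

theorem IsTest.partialDeriv {φ : Eu n → ℝ} (hφ : IsTest O φ) (i : Fin n) :
    IsTest O (partialDeriv i φ) := by
  have hs : tsupport (MatchedMicro.partialDeriv i φ) ⊆ tsupport φ := by
    refine closure_minimal (fun y hy => ?_) (isClosed_tsupport φ)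
    refine support_fderiv_subset ℝ fun h0 => hy ?_
    simp only [MatchedMicro.partialDeriv, h0, zero_apply]
  refine ⟨(hφ.1.fderiv_right (m := ∞) (by simp)).clm_apply contDiff_const, ?_, hs.trans hφ.2.2⟩
  exact hφ.2.1.of_isClosed_subset (isClosed_tsupport _) hs

theorem IsTest.memLp {φ : Eu n → ℝ} (hφ : IsTest O φ) : MemLp φ 2 (volume.restrict O) :=
  (hφ.continuous.memLp_of_hasCompactSupport hφ.2.1).restrict O

/-- A locally integrable function times a test function is integrable. -/
theorem IsTest.integrableOn_mul {φ : Eu n → ℝ} (hφ : IsTest O φ)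
    (hf : LocallyIntegrableOn f O) : IntegrableOn (fun y => f y * φ y) O := by
  have h1 : IntegrableOn (fun y => f y * φ y) (tsupport φ) :=
    (hf.integrableOn_compact_subset hφ.2.2 hφ.2.1).mul_continuousOn hφ.continuous.continuousOn
      hφ.2.1
  refine (h1.integrable_of_forall_notMem_eq_zero fun y hy => ?_).integrableOn
  rw [image_eq_zero_of_notMem_tsupport hy, mul_zero]

theorem HasWeakPartial.congr (hw : HasWeakPartial O i f h) (hf : f =ᵐ[volume.restrict O] g)
    (hd : h =ᵐ[volume.restrict O] d) : HasWeakPartial O i g d := by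
  refine ⟨hw.1.congr hf, hw.2.1.congr hd, fun φ hφ => ?_⟩
  have e1 : ∫ y in O, f y * partialDeriv i φ y = ∫ y in O, g y * partialDeriv i φ y :=
    integral_congr_ae (hf.mul (ae_eq_refl (partialDeriv i φ)))
  have e2 : ∫ y in O, h y * φ y = ∫ y in O, d y * φ y :=
    integral_congr_ae (hd.mul (ae_eq_refl φ))
  rw [← e1, ← e2]
  exact hw.2.2 φ hφ

/-- Weak derivatives are unique up to null sets. -/
theorem HasWeakPartial.ae_eq (hO : IsOpen O) (h1 : HasWeakPartial O i f h)
    (h2 : HasWeakPartial O i f d) : h =ᵐ[volume.restrict O] d := by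
  have key := hO.ae_eq_zero_of_integral_contDiff_smul_eq_zero (μ := volume)
    (f := fun y => h y - d y) (h1.2.1.sub h2.2.1) fun φ hφ1 hφ2 hφ3 => by
      have hφ : IsTest O φ := ⟨hφ1, hφ2, hφ3⟩
      rw [← setIntegral_eq_integral_of_forall_compl_eq_zero (s := O)
        fun y hy => by rw [hφ.eq_zero hy, zero_smul]]
      have e1 := h1.2.2 φ hφ
      have e2 := h2.2.2 φ hφ
      have : ∀ y, φ y • (h y - d y) = h y * φ y - d y * φ y := fun y => by
        rw [smul_eq_mul]; ring
      simp_rw [this]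
      rw [integral_sub (hφ.integrableOn_mul h1.2.1) (hφ.integrableOn_mul h2.2.1)]
      linarith
  rw [Filter.EventuallyEq, ae_restrict_iff' hO.measurableSet]
  filter_upwards [key] with y hy hyO
  exact sub_eq_zero.1 (hy hyO)

theorem HasWeakPartial.weakPartial (hw : HasWeakPartial O i f h) :
    HasWeakPartial O i f (weakPartial O i f) := by
  have hex : ∃ d, HasWeakPartial O i f d := ⟨h, hw⟩
  rw [MatchedMicro.weakPartial, dif_pos hex]
  exact hex.choose_spec

theorem HasWeakPartial.weakPartial_ae_eq (hO : IsOpen O) (hw : HasWeakPartial O i f h) :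
    MatchedMicro.weakPartial O i f =ᵐ[volume.restrict O] h :=
  hw.weakPartial.ae_eq hO hw

theorem MemW1.memLp_weakPartial (hO : IsOpen O) (hf : MemW1 O f) (i : Fin n) :
    MemLp (weakPartial O i f) 2 (volume.restrict O) := by
  obtain ⟨d, hd, hd2⟩ := hf.2 i
  exact (memLp_congr_ae (hd.weakPartial_ae_eq hO)).2 hd2

theorem MemW1.hasWeakPartial (hf : MemW1 O f) (i : Fin n) :
    HasWeakPartial O i f (weakPartial O i f) := by
  obtain ⟨d, hd, -⟩ := hf.2 i
  exact hd.weakPartial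

theorem MemW1.congr (hf : MemW1 O f) (hg : f =ᵐ[volume.restrict O] g) : MemW1 O g :=
  ⟨(memLp_congr_ae hg).1 hf.1, fun i => by
    obtain ⟨d, hd, hd2⟩ := hf.2 i
    exact ⟨d, hd.congr hg (ae_eq_refl d), hd2⟩⟩

theorem MemW2.memW1_weakPartial (hO : IsOpen O) (hf : MemW2 O f) (i : Fin n) :
    MemW1 O (weakPartial O i f) := by
  obtain ⟨d, hd, hd2⟩ := hf.2 i
  exact hd2.congr (hd.weakPartial_ae_eq hO).symm

/-- The test function `a φ`, for `a` smooth on `O` only. -/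
theorem IsTest.mul_contDiffOn (hO : IsOpen O) {a φ : Eu n → ℝ} (ha : ContDiffOn ℝ ∞ a O)
    (hφ : IsTest O φ) : IsTest O (fun y => a y * φ y) := by
  have hs : tsupport (fun y => a y * φ y) ⊆ tsupport φ := by
    refine closure_mono fun y hy h0 => hy ?_
    simp only [h0, mul_zero]
  refine ⟨contDiff_iff_contDiffAt.2 fun y => ?_, ?_, hs.trans hφ.2.2⟩
  · by_cases hy : y ∈ tsupport φ
    · exact (ha.contDiffAt (hO.mem_nhds (hφ.2.2 hy))).mul hφ.1.contDiffAt
    · have h0 : (fun y => a y * φ y) =ᶠ[𝓝 y] fun _ => 0 := by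
        filter_upwards [(isClosed_tsupport φ).isOpen_compl.mem_nhds hy] with z hz
        rw [image_eq_zero_of_notMem_tsupport hz, mul_zero]
      exact contDiffAt_const.congr_of_eventuallyEq h0
  · exact hφ.2.1.of_isClosed_subset (isClosed_tsupport _) hs

theorem partialDeriv_mul {a φ : Eu n → ℝ} {y : Eu n} (ha : DifferentiableAt ℝ a y)
    (hφ : DifferentiableAt ℝ φ y) (i : Fin n) :
    partialDeriv i (fun y => a y * φ y) y =
      partialDeriv i a y * φ y + a y * partialDeriv i φ y := by
  simp only [partialDeriv, fderiv_fun_mul ha hφ]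
  simp
  ring

theorem continuousOn_partialDeriv (hO : IsOpen O) {a : Eu n → ℝ} (ha : ContDiffOn ℝ ∞ a O)
    (i : Fin n) : ContinuousOn (partialDeriv i a) O :=
  (ha.continuousOn_fderiv_of_isOpen hO (by simp)).clm_apply continuousOn_const

/-- Product rule for a weakly differentiable function and a smooth one. -/
theorem HasWeakPartial.mul_contDiffOn (hO : IsOpen O) {a : Eu n → ℝ} (ha : ContDiffOn ℝ ∞ a O)
    (hw : HasWeakPartial O i f h) :
    HasWeakPartial O i (fun y => a y * f y) (fun y => partialDeriv i a y * f y + a y * h y) := by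
  have hloc : ∀ {b k : Eu n → ℝ}, ContinuousOn b O → LocallyIntegrableOn k O →
      LocallyIntegrableOn (fun y => b y * k y) O := by
    intro b k hb hk
    rw [locallyIntegrableOn_iff hO.isLocallyClosed] at hk ⊢
    intro K hKO hK
    exact (hk K hKO hK).continuousOn_mul (hb.mono hKO) hK
  have hda := continuousOn_partialDeriv hO ha i
  refine ⟨hloc ha.continuousOn hw.1, (hloc hda hw.1).add (hloc ha.continuousOn hw.2.1),
    fun φ hφ => ?_⟩
  have e := hw.2.2 _ (hφ.mul_contDiffOn hO ha)
  have e1 : ∫ y in O, f y * partialDeriv i (fun y => a y * φ y) y =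
      ∫ y in O, (a y * f y * partialDeriv i φ y + partialDeriv i a y * f y * φ y) := by
    refine setIntegral_congr_fun hO.measurableSet fun y hy => ?_
    rw [partialDeriv_mul ((ha.contDiffAt (hO.mem_nhds hy)).differentiableAt (by simp))
      (hφ.1.differentiable (by simp) y)]
    ring
  have i1 := (hφ.partialDeriv i).integrableOn_mul (hloc ha.continuousOn hw.1)
  have i2 := hφ.integrableOn_mul (hloc hda hw.1)
  have i3 := hφ.integrableOn_mul (hloc ha.continuousOn hw.2.1)
  rw [e1, integral_add i1 i2] at e
  have e2 : ∫ y in O, (partialDeriv i a y * f y + a y * h y) * φ y =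
      ∫ y in O, (partialDeriv i a y * f y * φ y + a y * h y * φ y) :=
    integral_congr_ae (Eventually.of_forall fun y => by simp only; ring)
  have e3 : ∫ y in O, h y * (a y * φ y) = ∫ y in O, a y * h y * φ y :=
    integral_congr_ae (Eventually.of_forall fun y => by simp only; ring)
  rw [e2, integral_add i2 i3]
  linarith

end Weak

/-! ### Traces on the unit sphere -/

theorem memLp_two_bdd_mul {α : Type*} [MeasurableSpace α] {μ : Measure α} {a f : α → ℝ} {C : ℝ}
    (hf : MemLp f 2 μ) (ha : AEStronglyMeasurable a μ) (hC : ∀ᵐ y ∂μ, |a y| ≤ C) :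
    MemLp (fun y => a y * f y) 2 μ := by
  refine hf.of_le_mul (c := C) (ha.mul hf.1) ?_
  filter_upwards [hC] with y hy
  rw [norm_mul]
  gcongr
  exact hy

theorem integrable_mul_of_memLp_two {α : Type*} [MeasurableSpace α] {μ : Measure α} {f g : α → ℝ}
    (hf : MemLp f 2 μ) (hg : MemLp g 2 μ) : Integrable (fun y => f y * g y) μ :=
  hf.integrable_mul hg

instance : IsFiniteMeasure ((volume : Measure (Eu n)).restrict (unitBall n)) :=
  ⟨by rw [Measure.restrict_apply_univ]; exact measure_ball_lt_top⟩

theorem isOpen_unitBall : IsOpen (unitBall n) := isOpen_ball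

theorem measurableSet_unitBall : MeasurableSet (unitBall n) := measurableSet_ball

theorem exists_bound_of_continuousOn_closedBall {a : Eu n → ℝ}
    (ha : ContinuousOn a (closedBall 0 1)) : ∃ C, ∀ y ∈ closedBall (0 : Eu n) 1, |a y| ≤ C :=
  (isCompact_closedBall (0 : Eu n) 1).exists_bound_of_continuousOn ha

theorem aestronglyMeasurable_of_continuousOn_closedBall {a : Eu n → ℝ}
    (ha : ContinuousOn a (closedBall 0 1)) :
    AEStronglyMeasurable a (volume.restrict (unitBall n)) :=
  (ha.mono ball_subset_closedBall).aestronglyMeasurable measurableSet_unitBall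

theorem memLp_mul_of_continuousOn_closedBall {a f : Eu n → ℝ}
    (ha : ContinuousOn a (closedBall 0 1)) (hf : MemLp f 2 (volume.restrict (unitBall n))) :
    MemLp (fun y => a y * f y) 2 (volume.restrict (unitBall n)) := by
  obtain ⟨C, hC⟩ := exists_bound_of_continuousOn_closedBall ha
  refine memLp_two_bdd_mul (C := C) hf (aestronglyMeasurable_of_continuousOn_closedBall ha) ?_
  filter_upwards [ae_restrict_mem measurableSet_unitBall] with y hy
    using hC y (ball_subset_closedBall hy)

theorem memLp_of_continuousOn_closedBall {a : Eu n → ℝ} (ha : ContinuousOn a (closedBall 0 1)) :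
    MemLp a 2 (volume.restrict (unitBall n)) := by
  simpa using memLp_mul_of_continuousOn_closedBall ha (memLp_const 1)

theorem continuous_comp_sphere {a : Eu n → ℝ} (ha : ContinuousOn a (closedBall 0 1)) :
    Continuous fun s : UnitSphere n => a s :=
  ha.comp_continuous continuous_subtype_val fun s => sphere_subset_closedBall s.2

theorem memLp_surface_of_continuous {b : UnitSphere n → ℝ} (hb : Continuous b) :
    MemLp b 2 (surface n) := by
  obtain ⟨C, hC⟩ := isCompact_univ.exists_bound_of_continuousOn hb.continuousOn
  exact MemLp.of_bound hb.aestronglyMeasurable C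
    (Eventually.of_forall fun s => hC s (Set.mem_univ s))

theorem memLp_surface_mul_of_continuous {b τ : UnitSphere n → ℝ} (hb : Continuous b)
    (hτ : MemLp τ 2 (surface n)) : MemLp (fun s => b s * τ s) 2 (surface n) := by
  obtain ⟨C, hC⟩ := isCompact_univ.exists_bound_of_continuousOn hb.continuousOn
  exact memLp_two_bdd_mul (C := C) hτ hb.aestronglyMeasurable
    (Eventually.of_forall fun s => hC s (Set.mem_univ s))

theorem continuous_mul_coord_sphere {a : Eu n → ℝ} (ha : ContinuousOn a (closedBall 0 1))
    (i : Fin n) : Continuous fun s : UnitSphere n => a s * (s : Eu n) i :=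
  (continuous_comp_sphere ha).mul (by fun_prop)

section Smooth

variable {a b : Eu n → ℝ} {i : Fin n}

theorem exists_lipschitzOnWith_closedBall (ha : ContDiffOn ℝ ∞ a (closedBall 0 1)) :
    ∃ K, LipschitzOnWith K a (closedBall 0 1) :=
  ha.exists_lipschitzOnWith (by simp) (convex_closedBall 0 1) (isCompact_closedBall 0 1)

theorem differentiableAt_of_contDiffOn_closedBall (ha : ContDiffOn ℝ ∞ a (closedBall 0 1))
    {y : Eu n} (hy : y ∈ unitBall n) : DifferentiableAt ℝ a y :=
  (ha.contDiffAt (mem_of_superset (isOpen_ball.mem_nhds hy) ball_subset_closedBall)).differentiableAt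
    (by simp)

theorem abs_partialDeriv_le_of_lipschitzOnWith {K : ℝ≥0} (ha : LipschitzOnWith K a (closedBall 0 1))
    (i : Fin n) {y : Eu n} (hy : y ∈ unitBall n) : |partialDeriv i a y| ≤ K := by
  have h := norm_fderiv_le_of_lipschitzOn ℝ
    (mem_of_superset (isOpen_ball.mem_nhds hy) ball_subset_closedBall) ha
  calc |partialDeriv i a y| ≤ ‖fderiv ℝ a y‖ * ‖(EuclideanSpace.single i (1 : ℝ) : Eu n)‖ :=
        (fderiv ℝ a y).le_opNorm _
    _ ≤ K := by simpa using h

theorem measurable_partialDeriv (i : Fin n) (a : Eu n → ℝ) : Measurable (partialDeriv i a) :=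
  measurable_fderiv_apply_const ℝ a _

theorem memLp_partialDeriv_mul (ha : ContDiffOn ℝ ∞ a (closedBall 0 1)) (i : Fin n) {f : Eu n → ℝ}
    (hf : MemLp f 2 (volume.restrict (unitBall n))) :
    MemLp (fun y => partialDeriv i a y * f y) 2 (volume.restrict (unitBall n)) := by
  obtain ⟨K, hK⟩ := exists_lipschitzOnWith_closedBall ha
  refine memLp_two_bdd_mul (C := K) hf (measurable_partialDeriv i a).aestronglyMeasurable ?_
  filter_upwards [ae_restrict_mem measurableSet_unitBall] with y hy
    using abs_partialDeriv_le_of_lipschitzOnWith hK i hy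

theorem memLp_partialDeriv (ha : ContDiffOn ℝ ∞ a (closedBall 0 1)) (i : Fin n) :
    MemLp (partialDeriv i a) 2 (volume.restrict (unitBall n)) := by
  simpa using memLp_partialDeriv_mul ha i (memLp_const 1)

/-- Integration by parts on the unit ball, for functions smooth up to the sphere. -/
theorem integral_unitBall_mul_partialDeriv (hn : 1 ≤ n) (ha : ContDiffOn ℝ ∞ a (closedBall 0 1))
    (hb : ContDiffOn ℝ ∞ b (closedBall 0 1)) (i : Fin n) :
    (∫ y in unitBall n, partialDeriv i a y * b y) + ∫ y in unitBall n, a y * partialDeriv i b y =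
      ∫ s : UnitSphere n, a s * b s * (s : Eu n) i ∂(surface n) := by
  have hab : ContDiffOn ℝ ∞ (fun y => a y * b y) (closedBall 0 1) := ha.mul hb
  obtain ⟨K, hK⟩ := exists_lipschitzOnWith_closedBall hab
  rw [← integral_unitBall_partialDeriv hn hK
    (fun y hy => (differentiableAt_of_contDiffOn_closedBall hab hy).differentiableWithinAt),
    ← integral_add (integrable_mul_of_memLp_two (memLp_partialDeriv ha i)
      (memLp_of_continuousOn_closedBall hb.continuousOn))
      (integrable_mul_of_memLp_two (memLp_of_continuousOn_closedBall ha.continuousOn)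
        (memLp_partialDeriv hb i))]
  refine setIntegral_congr_fun measurableSet_unitBall fun y hy => ?_
  exact (partialDeriv_mul (differentiableAt_of_contDiffOn_closedBall ha hy)
    (differentiableAt_of_contDiffOn_closedBall hb hy) i).symm

theorem contDiff_coord (i : Fin n) : ContDiff ℝ ∞ fun y : Eu n => y i :=
  contDiff_piLp_apply (p := 2)

theorem partialDeriv_coord (i : Fin n) (y : Eu n) : partialDeriv i (fun y : Eu n => y i) y = 1 := by
  have h : HasFDerivAt (fun y : Eu n => y i) (EuclideanSpace.proj i : Eu n →L[ℝ] ℝ) y :=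
    (EuclideanSpace.proj i : Eu n →L[ℝ] ℝ).hasFDerivAt
  rw [partialDeriv, h.fderiv]
  simp

theorem norm_sq_eq_sum (y : Eu n) : ‖y‖ ^ 2 = ∑ i, y i ^ 2 := by
  simp [EuclideanSpace.norm_sq_eq]

theorem two_mul_sum_le (v : ℝ) (p : Fin n → ℝ) {y : Eu n} {R : ℝ} (hy : ‖y‖ ≤ R) :
    |2 * ∑ i, v * y i * p i| ≤ 1 / 2 * v ^ 2 + 2 * R ^ 2 * ∑ i, p i ^ 2 := by
  have h1 : (∑ i, y i * p i) ^ 2 ≤ R ^ 2 * ∑ i, p i ^ 2 := by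
    refine (Finset.sum_mul_sq_le_sq_mul_sq _ _ _).trans ?_
    rw [← norm_sq_eq_sum]
    have := Finset.sum_nonneg fun i (_ : i ∈ Finset.univ) => sq_nonneg (p i)
    gcongr
  have h2 : ∑ i, v * y i * p i = v * ∑ i, y i * p i := by
    rw [Finset.mul_sum]; exact Finset.sum_congr rfl fun i _ => by ring
  rw [h2, abs_le]
  constructor <;> nlinarith [sq_nonneg (v - 2 * ∑ i, y i * p i), sq_nonneg (v + 2 * ∑ i, y i * p i)]

/-- The divergence theorem for the vector field `φ² y` compares the sphere and volume integrals of
`φ²`; this yields both the trace inequality and a Poincaré inequality. -/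
theorem abs_integral_sphere_sq_sub_le_of_contDiff (hn : 1 ≤ n) {φ : Eu n → ℝ}
    (hφ : ContDiff ℝ ∞ φ) :
    |(∫ s : UnitSphere n, φ s ^ 2 ∂(surface n)) - n * ∫ y in unitBall n, φ y ^ 2| ≤
      1 / 2 * (∫ y in unitBall n, φ y ^ 2) +
        2 * ∑ i, ∫ y in unitBall n, partialDeriv i φ y ^ 2 := by
  have hφ' : ContDiffOn ℝ ∞ φ (closedBall 0 1) := hφ.contDiffOn
  have m0 := memLp_of_continuousOn_closedBall hφ'.continuousOn
  have m1 := fun i => memLp_partialDeriv hφ' i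
  have m2 : ∀ i, MemLp (fun y => φ y * y i) 2 (volume.restrict (unitBall n)) := fun i =>
    memLp_of_continuousOn_closedBall (hφ.mul (contDiff_coord i)).continuous.continuousOn
  have e1 : ∀ i, (∫ y in unitBall n, φ y * y i * partialDeriv i φ y) * 2 +
      ∫ y in unitBall n, φ y ^ 2 =
        ∫ s : UnitSphere n, φ s ^ 2 * ((s : Eu n) i) ^ 2 ∂(surface n) := by
    intro i
    have e := integral_unitBall_mul_partialDeriv hn
      (hφ.mul (contDiff_coord i)).contDiffOn hφ' i
    have e' : ∫ y in unitBall n, partialDeriv i (fun y => φ y * y i) y * φ y =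
        (∫ y in unitBall n, φ y * y i * partialDeriv i φ y) + ∫ y in unitBall n, φ y ^ 2 := by
      rw [← integral_add (integrable_mul_of_memLp_two (m2 i) (m1 i)) m0.integrable_sq]
      refine integral_congr_ae (Eventually.of_forall fun y => ?_)
      simp only
      rw [partialDeriv_mul (hφ.differentiable (by simp) y)
        ((contDiff_coord i).differentiable (by simp) y), partialDeriv_coord]
      ring
    rw [e'] at e
    have e2 : ∫ s : UnitSphere n, φ s ^ 2 * ((s : Eu n) i) ^ 2 ∂(surface n) =
        ∫ s : UnitSphere n, φ s * (s : Eu n) i * φ s * (s : Eu n) i ∂(surface n) :=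
      integral_congr_ae (Eventually.of_forall fun s => by simp only; ring)
    rw [e2, ← e]
    ring
  have e2 : ∑ i, ∫ s : UnitSphere n, φ s ^ 2 * ((s : Eu n) i) ^ 2 ∂(surface n) =
      ∫ s : UnitSphere n, φ s ^ 2 ∂(surface n) := by
    rw [← integral_finsetSum]
    · refine integral_congr_ae (Eventually.of_forall fun s => ?_)
      simp only
      rw [← Finset.mul_sum, ← norm_sq_eq_sum, norm_eq_of_mem_sphere]
      ring
    · intro i _
      have hc : Continuous fun s : UnitSphere n => φ s ^ 2 * ((s : Eu n) i) ^ 2 := by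
        have := hφ.continuous
        fun_prop
      exact (memLp_surface_of_continuous hc).integrable (by norm_num)
  have e3 : (∫ s : UnitSphere n, φ s ^ 2 ∂(surface n)) - n * ∫ y in unitBall n, φ y ^ 2 =
      ∫ y in unitBall n, 2 * ∑ i, φ y * y i * partialDeriv i φ y := by
    rw [← e2, ← Finset.sum_congr rfl fun i _ => e1 i, Finset.sum_add_distrib, integral_const_mul,
      integral_finsetSum _ fun i _ => integrable_mul_of_memLp_two (m2 i) (m1 i), ← Finset.sum_mul]
    simp
    ring
  rw [e3]
  have hb : 1 / 2 * (∫ y in unitBall n, φ y ^ 2) +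
      2 * ∑ i, ∫ y in unitBall n, partialDeriv i φ y ^ 2 =
      ∫ y in unitBall n, (1 / 2 * φ y ^ 2 + 2 * 1 ^ 2 * ∑ i, partialDeriv i φ y ^ 2) := by
    rw [integral_add (m0.integrable_sq.const_mul _)
      ((integrable_finsetSum _ fun i _ => (m1 i).integrable_sq).const_mul _), integral_const_mul,
      integral_const_mul, integral_finsetSum _ fun i _ => (m1 i).integrable_sq]
    norm_num
  rw [hb]
  refine (abs_integral_le_integral_abs).trans (integral_mono_of_nonneg
    (Eventually.of_forall fun y => abs_nonneg _) ?_ ?_)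
  · exact (m0.integrable_sq.const_mul _).add
      ((integrable_finsetSum _ fun i _ => (m1 i).integrable_sq).const_mul _)
  · filter_upwards [ae_restrict_mem measurableSet_unitBall] with y hy
    exact two_mul_sum_le _ _ (by simpa [unitBall] using le_of_lt (mem_ball.1 hy))

end Smooth

section Trace

variable {v D : Eu n → ℝ} {τ : UnitSphere n → ℝ} {a : Eu n → ℝ}

theorem IsSphereTrace.abs_sub_le (hn : 1 ≤ n) (h : IsSphereTrace v τ) :
    |(∫ s, τ s ^ 2 ∂(surface n)) - n * ∫ y in unitBall n, v y ^ 2| ≤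
      1 / 2 * (∫ y in unitBall n, v y ^ 2) +
        2 * ∑ i, ∫ y in unitBall n, weakPartial (unitBall n) i v y ^ 2 := by
  obtain ⟨hv, hτ, φ, hφ, hφv, hφτ⟩ := h
  have t0 := tendsto_integral_sq (fun k => memLp_surface_of_continuous
    (continuous_comp_sphere (hφ k).continuous.continuousOn)) hτ hφτ
  have t1 := tendsto_integral_sq (fun k => memLp_of_continuousOn_closedBall
    (hφ k).continuous.continuousOn) hv.1 hφv.1
  have t2 := fun i => tendsto_integral_sq (fun k => memLp_partialDeriv (hφ k).contDiffOn i)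
    (hv.memLp_weakPartial isOpen_unitBall i) (hφv.2 i)
  refine le_of_tendsto_of_tendsto' (t0.sub (t1.const_mul _)).abs ((t1.const_mul _).add
    ((tendsto_finsetSum _ fun i _ => t2 i).const_mul _)) fun k => ?_
  exact abs_integral_sphere_sq_sub_le_of_contDiff hn (hφ k)

/-- The trace inequality. -/
theorem IsSphereTrace.integral_sq_le (hn : 1 ≤ n) (h : IsSphereTrace v τ) :
    ∫ s, τ s ^ 2 ∂(surface n) ≤ (n + 1) * (∫ y in unitBall n, v y ^ 2) +
        2 * ∑ i, ∫ y in unitBall n, weakPartial (unitBall n) i v y ^ 2 := by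
  have h1 := (abs_le.1 (h.abs_sub_le hn)).2
  have h2 : 0 ≤ ∫ y in unitBall n, v y ^ 2 := integral_nonneg fun y => sq_nonneg _
  linarith

/-- Poincaré's inequality with a boundary term. -/
theorem IsSphereTrace.integral_unitBall_sq_le (hn : 1 ≤ n) (h : IsSphereTrace v τ) :
    ∫ y in unitBall n, v y ^ 2 ≤ 2 * (∫ s, τ s ^ 2 ∂(surface n)) +
        4 * ∑ i, ∫ y in unitBall n, weakPartial (unitBall n) i v y ^ 2 := by
  have h1 := (abs_le.1 (h.abs_sub_le hn)).1
  have h2 : 0 ≤ ∫ y in unitBall n, v y ^ 2 := integral_nonneg fun y => sq_nonneg _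
  have h3 : (1 : ℝ) ≤ n := by exact_mod_cast hn
  have h4 := mul_le_mul_of_nonneg_right h3 h2
  linarith

/-- Integration by parts on the unit ball against a function smooth up to the sphere. -/
theorem IsSphereTrace.integral_mul (hn : 1 ≤ n) (h : IsSphereTrace v τ)
    (ha : ContDiffOn ℝ ∞ a (closedBall 0 1)) (i : Fin n) :
    (∫ y in unitBall n, partialDeriv i a y * v y) +
        ∫ y in unitBall n, a y * weakPartial (unitBall n) i v y =
      ∫ s : UnitSphere n, a s * τ s * (s : Eu n) i ∂(surface n) := by
  obtain ⟨hv, hτ, φ, hφ, hφv, hφτ⟩ := h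
  have hac := continuous_mul_coord_sphere ha.continuousOn i
  have t0 := tendsto_integral_mul_left (fun k => memLp_surface_of_continuous
    (continuous_comp_sphere (hφ k).continuous.continuousOn)) hτ
    (memLp_surface_of_continuous hac) hφτ
  have t1 := tendsto_integral_mul_left (fun k => memLp_of_continuousOn_closedBall
    (hφ k).continuous.continuousOn) hv.1 (memLp_partialDeriv ha i) hφv.1
  have t2 := tendsto_integral_mul_left (fun k => memLp_partialDeriv (hφ k).contDiffOn i)
    (hv.memLp_weakPartial isOpen_unitBall i) (memLp_of_continuousOn_closedBall ha.continuousOn)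
    (hφv.2 i)
  have hlim := tendsto_nhds_unique (t1.add t2) (t0.congr fun k => ?_)
  · convert hlim using 2
    · simp only [mul_comm]
    · simp only [mul_comm]
    · ext s; ring
  · have e := integral_unitBall_mul_partialDeriv hn ha (hφ k).contDiffOn i
    convert e.symm using 2
    · ext s; ring
    · simp only [mul_comm]
    · simp only [mul_comm]

/-- Green's formula: integration by parts for the product of `a D` with a function `v` of constant
trace. -/
theorem IsSphereTrace.integral_mul_of_const (hn : 1 ≤ n) {c : ℝ} (hD : IsSphereTrace D τ)
    (hv : IsSphereTrace v fun _ => c) (ha : ContDiffOn ℝ ∞ a (closedBall 0 1)) (i : Fin n) :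
    (∫ y in unitBall n,
        (partialDeriv i a y * D y + a y * weakPartial (unitBall n) i D y) * v y) +
        ∫ y in unitBall n, a y * D y * weakPartial (unitBall n) i v y =
      c * ∫ s : UnitSphere n, a s * τ s * (s : Eu n) i ∂(surface n) := by
  obtain ⟨hv, -, φ, hφ, hφv, hφτ⟩ := hv
  have hac := continuous_mul_coord_sphere ha.continuousOn i
  have mD := hD.1.1
  have mτ := hD.2.1
  have m1 : MemLp (fun y => partialDeriv i a y * D y + a y * weakPartial (unitBall n) i D y) 2
      (volume.restrict (unitBall n)) :=
    (memLp_partialDeriv_mul ha i mD).add (memLp_mul_of_continuousOn_closedBall ha.continuousOn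
      (hD.1.memLp_weakPartial isOpen_unitBall i))
  have m2 := memLp_mul_of_continuousOn_closedBall ha.continuousOn mD
  have t0 := tendsto_integral_mul_left (fun k => memLp_surface_of_continuous
    (continuous_comp_sphere (hφ k).continuous.continuousOn)) (memLp_const c)
    (memLp_surface_mul_of_continuous hac mτ) hφτ
  have t1 := tendsto_integral_mul_left (fun k => memLp_of_continuousOn_closedBall
    (hφ k).continuous.continuousOn) hv.1 m1 hφv.1
  have t2 := tendsto_integral_mul_left (fun k => memLp_partialDeriv (hφ k).contDiffOn i)
    (hv.memLp_weakPartial isOpen_unitBall i) m2 (hφv.2 i)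
  have hlim := tendsto_nhds_unique (t1.add t2) (t0.congr fun k => ?_)
  · rw [integral_const_mul] at hlim
    convert hlim using 2
    · simp only [mul_comm]
    · simp only [mul_comm]
    · congr 1; ext s; ring
  · have e := hD.integral_mul hn (ha.mul (hφ k).contDiffOn) i
    have hφk : ContDiffOn ℝ ∞ (φ k) (closedBall 0 1) := (hφ k).contDiffOn
    have mφ := memLp_of_continuousOn_closedBall hφk.continuousOn
    have q1 : ∫ y in unitBall n, partialDeriv i (fun y => a y * φ k y) y * D y =
        (∫ y in unitBall n, partialDeriv i a y * D y * φ k y) +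
          ∫ y in unitBall n, partialDeriv i (φ k) y * (a y * D y) := by
      rw [← integral_add (integrable_mul_of_memLp_two (memLp_partialDeriv_mul ha i mD) mφ)
        (integrable_mul_of_memLp_two (memLp_partialDeriv hφk i) m2)]
      refine setIntegral_congr_fun measurableSet_unitBall fun y hy => ?_
      rw [partialDeriv_mul (differentiableAt_of_contDiffOn_closedBall ha hy)
        (differentiableAt_of_contDiffOn_closedBall hφk hy)]
      ring
    have q2 : ∫ y in unitBall n, φ k y *
        (partialDeriv i a y * D y + a y * weakPartial (unitBall n) i D y) =
        (∫ y in unitBall n, partialDeriv i a y * D y * φ k y) +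
          ∫ y in unitBall n, a y * φ k y * weakPartial (unitBall n) i D y := by
      rw [← integral_add (integrable_mul_of_memLp_two (memLp_partialDeriv_mul ha i mD) mφ)
        (integrable_mul_of_memLp_two
          (memLp_mul_of_continuousOn_closedBall ha.continuousOn mφ)
          (hD.1.memLp_weakPartial isOpen_unitBall i))]
      exact integral_congr_ae (Eventually.of_forall fun y => by simp only; ring)
    have q3 : ∫ s : UnitSphere n, a s * φ k s * τ s * (s : Eu n) i ∂(surface n) =
        ∫ s : UnitSphere n, φ k s * (a s * (s : Eu n) i * τ s) ∂(surface n) :=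
      integral_congr_ae (Eventually.of_forall fun s => by simp only; ring)
    rw [q2, ← q3, ← e, q1]
    ring

end Trace

/-! ### Approximation by functions smooth up to the sphere -/

section Density

open ContinuousLinearMap (lsmul)
open scoped Convolution

/-- The radius `1 / (k + 4)` of the `k`-th mollifier. -/
noncomputable def mollRadius (k : ℕ) : ℝ := 1 / ((k : ℝ) + 4)

theorem mollRadius_pos (k : ℕ) : 0 < mollRadius k := by unfold mollRadius; positivity

theorem mollRadius_le (k : ℕ) : mollRadius k ≤ 1 / 4 := by
  unfold mollRadius
  gcongr
  linarith [k.cast_nonneg (α := ℝ)]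

theorem tendsto_mollRadius : Tendsto mollRadius atTop (𝓝 0) := by
  have := (tendsto_one_div_add_atTop_nhds_zero_nat (𝕜 := ℝ)).comp (tendsto_add_atTop_nat 3)
  refine this.congr fun k => ?_
  simp [mollRadius]; ring

/-- The `k`-th mollifier, before normalization. -/
noncomputable def mollBump (n k : ℕ) : ContDiffBump (0 : Eu n) where
  rIn := mollRadius k / 2
  rOut := mollRadius k
  rIn_pos := half_pos (mollRadius_pos k)
  rIn_lt_rOut := half_lt_self (mollRadius_pos k)

/-- The mollification of `F`, rescaled by the factor `1 - 2 ε` for the radius `ε` of the mollifier,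
so that its values on the closed unit ball depend only on the values of `F` in the open one. -/
noncomputable def dilMollify (k : ℕ) (F : Eu n → ℝ) (y : Eu n) : ℝ :=
  ((mollBump n k).normed volume ⋆[lsmul ℝ ℝ, volume] F) ((1 - 2 * mollRadius k) • y)

variable {F : Eu n → ℝ} {k : ℕ}

theorem contDiff_dilMollify (hF : LocallyIntegrable F) : ContDiff ℝ ∞ (dilMollify k F) := by
  have h := (mollBump n k).hasCompactSupport_normed (μ := volume) |>.contDiff_convolution_left
    (n := ⊤) (lsmul ℝ ℝ) ((mollBump n k).contDiff_normed (μ := volume)) hF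
  exact h.comp (contDiff_const_smul (1 - 2 * mollRadius k))

theorem integrable_normed_mul (hF : LocallyIntegrable F) (x : Eu n) :
    Integrable fun t => (mollBump n k).normed volume t * F (x - t) :=
  (mollBump n k).hasCompactSupport_normed.convolutionExists_left (lsmul ℝ ℝ)
    (mollBump n k).continuous_normed hF x

/-- Mollification does not increase the mean square. -/
theorem convolution_sq_le (hF : MemLp F 2) (x : Eu n) :
    (((mollBump n k).normed volume ⋆[lsmul ℝ ℝ, volume] F) x) ^ 2 ≤
      ((mollBump n k).normed volume ⋆[lsmul ℝ ℝ, volume] fun w => F w ^ 2) x := by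
  set ρ := (mollBump n k).normed (volume : Measure (Eu n)) with hρ
  set m := (ρ ⋆[lsmul ℝ ℝ, volume] F) x with hm
  have i1 := integrable_normed_mul (k := k) (hF.locallyIntegrable (by norm_num)) x
  have i2 := integrable_normed_mul (k := k) hF.integrable_sq.locallyIntegrable x
  have i3 := (mollBump n k).integrable_normed (μ := volume)
  have e1 : m = ∫ t, ρ t * F (x - t) := rfl
  have e2 : (ρ ⋆[lsmul ℝ ℝ, volume] fun w => F w ^ 2) x = ∫ t, ρ t * F (x - t) ^ 2 := rfl
  have e3 : ∫ t, ρ t = 1 := (mollBump n k).integral_normed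
  -- The variance with respect to the probability density `ρ` is nonnegative.
  have h0 : 0 ≤ ∫ t, ρ t * (F (x - t) - m) ^ 2 :=
    integral_nonneg fun t => mul_nonneg ((mollBump n k).nonneg_normed t) (sq_nonneg _)
  have e4 : ∫ t, ρ t * (F (x - t) - m) ^ 2 =
      ∫ t, (ρ t * F (x - t) ^ 2 - 2 * m * (ρ t * F (x - t)) + m ^ 2 * ρ t) :=
    integral_congr_ae (Eventually.of_forall fun t => by simp only; ring)
  have e5 : ∫ t, (ρ t * F (x - t) ^ 2 - 2 * m * (ρ t * F (x - t)) + m ^ 2 * ρ t) =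
      (∫ t, ρ t * F (x - t) ^ 2) - 2 * m * (∫ t, ρ t * F (x - t)) + m ^ 2 * ∫ t, ρ t := by
    have i4 : Integrable fun t => ρ t * F (x - t) ^ 2 - 2 * m * (ρ t * F (x - t)) :=
      i2.sub (i1.const_mul _)
    rw [integral_add i4 (i3.const_mul _), integral_sub i2 (i1.const_mul _), integral_const_mul, integral_const_mul]
  rw [e2]
  rw [e4, e5, ← e1, e3] at h0
  linarith

theorem memLp_dilMollify (hF : MemLp F 2) :
    MemLp (dilMollify k F) 2 (volume.restrict (unitBall n)) :=
  memLp_of_continuousOn_closedBall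
    (contDiff_dilMollify (hF.locallyIntegrable (by norm_num))).continuous.continuousOn

theorem integral_dilMollify_sq_le (hF : MemLp F 2) :
    ∫ y in unitBall n, dilMollify k F y ^ 2 ≤ 2 ^ n * ∫ y, F y ^ 2 := by
  set ρ := (mollBump n k).normed (volume : Measure (Eu n)) with hρ
  set c := 1 - 2 * mollRadius k with hc
  have hc2 : 1 / 2 ≤ c := by linarith [mollRadius_le k]
  have is : Integrable (ρ ⋆[lsmul ℝ ℝ, volume] fun w => F w ^ 2) :=
    (mollBump n k).integrable_normed.integrable_convolution (lsmul ℝ ℝ) hF.integrable_sq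
  have hcont : Continuous (ρ ⋆[lsmul ℝ ℝ, volume] F) :=
    ((mollBump n k).hasCompactSupport_normed.contDiff_convolution_left (n := 0) (lsmul ℝ ℝ)
      ((mollBump n k).contDiff_normed) (hF.locallyIntegrable (by norm_num))).continuous
  have im : Integrable fun x => (ρ ⋆[lsmul ℝ ℝ, volume] F) x ^ 2 := by
    refine is.mono' (hcont.pow 2).aestronglyMeasurable (Eventually.of_forall fun x => ?_)
    rw [Real.norm_of_nonneg (sq_nonneg _)]
    exact convolution_sq_le hF x
  have hle : ∫ x, (ρ ⋆[lsmul ℝ ℝ, volume] F) x ^ 2 ≤ ∫ y, F y ^ 2 := by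
    refine (integral_mono im is fun x => convolution_sq_le hF x).trans (le_of_eq ?_)
    rw [integral_convolution (lsmul ℝ ℝ) (mollBump n k).integrable_normed hF.integrable_sq,
      (mollBump n k).integral_normed]
    simp
  have hs := Measure.integral_comp_smul (volume : Measure (Eu n))
    (fun x => (ρ ⋆[lsmul ℝ ℝ, volume] F) x ^ 2) c
  rw [finrank_eu] at hs
  calc ∫ y in unitBall n, dilMollify k F y ^ 2
      ≤ ∫ y, dilMollify k F y ^ 2 :=
        setIntegral_le_integral (im.comp_smul (show c ≠ 0 by linarith))
          (Eventually.of_forall fun y => sq_nonneg _)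
    _ = |(c ^ n)⁻¹| * ∫ x, (ρ ⋆[lsmul ℝ ℝ, volume] F) x ^ 2 := hs
    _ ≤ 2 ^ n * ∫ y, F y ^ 2 := by
        have h2 : |(c ^ n)⁻¹| ≤ 2 ^ n := by
          rw [abs_of_nonneg (by positivity), ← inv_pow]
          gcongr
          rw [inv_le_comm₀ (by linarith) (by norm_num)]
          linarith
        have h3 : 0 ≤ ∫ x, (ρ ⋆[lsmul ℝ ℝ, volume] F) x ^ 2 := integral_nonneg fun x => sq_nonneg _
        gcongr

theorem eLpNorm_dilMollify_le (hF : MemLp F 2) :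
    eLpNorm (dilMollify k F) 2 (volume.restrict (unitBall n)) ≤
      ENNReal.ofReal (Real.sqrt (2 ^ n)) * eLpNorm F 2 volume := by
  rw [eLpNorm_two_eq_ofReal_sqrt (memLp_dilMollify hF), eLpNorm_two_eq_ofReal_sqrt hF,
    ← ENNReal.ofReal_mul (Real.sqrt_nonneg _), ← Real.sqrt_mul (by positivity)]
  exact ENNReal.ofReal_le_ofReal (Real.sqrt_le_sqrt (integral_dilMollify_sq_le hF))

theorem tendsto_dilMollify_of_continuous {g : Eu n → ℝ} (hg : Continuous g)
    (hgc : HasCompactSupport g) :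
    Tendsto (fun k => eLpNorm (fun y => dilMollify k g y - g y) 2 (volume.restrict (unitBall n)))
      atTop (𝓝 0) := by
  set V := (volume.restrict (unitBall n)) Set.univ ^ (2 : ℝ≥0∞).toReal⁻¹ with hV
  have hVt : V ≠ ⊤ := ENNReal.rpow_ne_top_of_nonneg (by simp) (measure_ne_top _ _)
  have huc := Metric.uniformContinuous_iff.1 (hgc.uniformContinuous_of_continuous hg)
  have key : ∀ δ : ℝ, 0 < δ → ∀ᶠ k in atTop,
      eLpNorm (fun y => dilMollify k g y - g y) 2 (volume.restrict (unitBall n)) ≤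
        V * ENNReal.ofReal δ := by
    intro δ hδ
    obtain ⟨η, hη, hgη⟩ := huc (δ / 2) (by positivity)
    filter_upwards [tendsto_mollRadius.eventually_lt_const (show 0 < η / 2 by positivity)] with k hk
    refine eLpNorm_le_of_ae_bound ?_
    filter_upwards [ae_restrict_mem measurableSet_unitBall] with y hy
    have hy1 : ‖y‖ < 1 := by simpa [unitBall] using hy
    have hk0 := mollRadius_pos k
    have h1 : dist (dilMollify k g y) (g ((1 - 2 * mollRadius k) • y)) ≤ δ / 2 := by
      refine (mollBump n k).dist_normed_convolution_le hg.aestronglyMeasurable fun x hx => ?_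
      refine (hgη ?_).le
      have : dist x ((1 - 2 * mollRadius k) • y) < mollRadius k := hx
      linarith
    have h2 : dist (g ((1 - 2 * mollRadius k) • y)) (g y) ≤ δ / 2 := by
      refine (hgη ?_).le
      rw [dist_eq_norm, show (1 - 2 * mollRadius k) • y - y = (-(2 * mollRadius k)) • y by module,
        norm_smul, Real.norm_eq_abs, abs_neg, abs_of_pos (by positivity)]
      nlinarith [norm_nonneg y]
    rw [← dist_eq_norm]
    linarith [dist_triangle (dilMollify k g y) (g ((1 - 2 * mollRadius k) • y)) (g y)]
  rw [ENNReal.tendsto_nhds_zero]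
  intro ε hε
  obtain ⟨δ, hδ, hδε⟩ : ∃ δ : ℝ, 0 < δ ∧ V * ENNReal.ofReal δ ≤ ε := by
    have ht : Tendsto (fun δ : ℝ => V * ENNReal.ofReal δ) (𝓝[>] 0) (𝓝 0) := by
      have h0 : Tendsto (fun δ : ℝ => δ) (𝓝[>] 0) (𝓝 0) := tendsto_id.mono_left nhdsWithin_le_nhds
      simpa using ENNReal.Tendsto.const_mul (a := V) (ENNReal.tendsto_ofReal h0) (Or.inr hVt)
    obtain ⟨δ, h1, h2⟩ := ((ht.eventually_le_const hε).and self_mem_nhdsWithin).exists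
    exact ⟨δ, h2, h1⟩
  filter_upwards [key δ hδ] with k hk using hk.trans hδε

theorem dilMollify_add {G : Eu n → ℝ} (hF : LocallyIntegrable F) (hG : LocallyIntegrable G)
    (y : Eu n) : dilMollify k (F + G) y = dilMollify k F y + dilMollify k G y := by
  have h : ∀ {H : Eu n → ℝ}, LocallyIntegrable H → ConvolutionExists
      ((mollBump n k).normed volume) H (lsmul ℝ ℝ) volume := fun hH =>
    (mollBump n k).hasCompactSupport_normed.convolutionExists_left (lsmul ℝ ℝ)
      (mollBump n k).continuous_normed hH
  exact (h hF _).distrib_add (h hG _)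

theorem tendsto_dilMollify (hF : MemLp F 2) :
    Tendsto (fun k => eLpNorm (fun y => dilMollify k F y - F y) 2 (volume.restrict (unitBall n)))
      atTop (𝓝 0) := by
  set C := ENNReal.ofReal (Real.sqrt (2 ^ n)) with hC
  rw [ENNReal.tendsto_nhds_zero]
  intro ε hε
  obtain ⟨δ, hδ, hδε⟩ : ∃ δ : ℝ≥0∞, δ ≠ 0 ∧ C * δ + δ ≤ ε / 2 := by
    have ht : Tendsto (fun δ : ℝ≥0∞ => C * δ + δ) (𝓝[>] 0) (𝓝 0) := by
      have h1 : Tendsto (fun δ : ℝ≥0∞ => δ) (𝓝[>] 0) (𝓝 0) :=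
        tendsto_id.mono_left nhdsWithin_le_nhds
      simpa using (ENNReal.Tendsto.const_mul (a := C) h1 (Or.inr ENNReal.ofReal_ne_top)).add h1
    obtain ⟨δ, h1, h2⟩ := ((ht.eventually_le_const (ENNReal.half_pos hε.ne')).and
      self_mem_nhdsWithin).exists
    exact ⟨δ, (Set.mem_Ioi.1 h2).ne', h1⟩
  obtain ⟨g, hgc, hFg, hg, hgL⟩ := hF.exists_hasCompactSupport_eLpNorm_sub_le (by simp) hδ
  filter_upwards [ENNReal.tendsto_nhds_zero.1 (tendsto_dilMollify_of_continuous hg hgc) (ε / 2)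
    (ENNReal.half_pos hε.ne')] with k hk
  have hFgL : MemLp (F - g) 2 := hF.sub hgL
  have hdec : (fun y => dilMollify k F y - F y) =
      (dilMollify k (F - g) + fun y => dilMollify k g y - g y) + (g - F) := by
    ext y
    have h := dilMollify_add (k := k) (hFgL.locallyIntegrable (by norm_num))
      (hgL.locallyIntegrable (by norm_num)) y
    rw [sub_add_cancel] at h
    simp only [Pi.add_apply, Pi.sub_apply, h]
    ring
  have m1 := (memLp_dilMollify (k := k) hFgL).1
  have m2 := ((memLp_dilMollify (k := k) hgL).1.sub hg.aestronglyMeasurable)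
  have m3 : AEStronglyMeasurable (g - F) (volume.restrict (unitBall n)) :=
    (hgL.sub hF).1.restrict
  rw [hdec]
  calc _ ≤ (eLpNorm (dilMollify k (F - g)) 2 (volume.restrict (unitBall n)) +
        eLpNorm (fun y => dilMollify k g y - g y) 2 (volume.restrict (unitBall n))) +
        eLpNorm (g - F) 2 (volume.restrict (unitBall n)) :=
        (eLpNorm_add_le (m1.add m2) m3 (by norm_num)).trans (by
          gcongr; exact eLpNorm_add_le m1 m2 (by norm_num))
    _ ≤ (C * δ + ε / 2) + δ := by
        gcongr
        · exact (eLpNorm_dilMollify_le hFgL).trans (by gcongr)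
        · refine (eLpNorm_mono_measure _ Measure.restrict_le_self).trans ?_
          rwa [eLpNorm_sub_comm]
    _ = (C * δ + δ) + ε / 2 := by ring
    _ ≤ ε / 2 + ε / 2 := by gcongr
    _ = ε := ENNReal.add_halves ε

/-- On the closed unit ball, differentiation commutes with the dilated mollification, up to the
dilation factor. -/
theorem partialDeriv_dilMollify {i : Fin n} {f d : Eu n → ℝ}
    (hf : MemLp f 2 (volume.restrict (unitBall n))) (hd : HasWeakPartial (unitBall n) i f d)
    {y : Eu n} (hy : y ∈ unitBall n) :
    partialDeriv i (dilMollify k ((unitBall n).indicator f)) y =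
      (1 - 2 * mollRadius k) * dilMollify k ((unitBall n).indicator d) y := by
  set ρ := (mollBump n k).normed (volume : Measure (Eu n)) with hρ
  set c := 1 - 2 * mollRadius k with hc
  set F := (unitBall n).indicator f with hF
  have hFL : LocallyIntegrable F :=
    ((memLp_indicator_iff_restrict measurableSet_unitBall).2 hf).locallyIntegrable (by norm_num)
  have hρs : ContDiff ℝ ∞ ρ := (mollBump n k).contDiff_normed
  have hρc : HasCompactSupport ρ := (mollBump n k).hasCompactSupport_normed
  set e : Eu n := EuclideanSpace.single i 1 with he
  have h1 := hρc.hasFDerivAt_convolution_left (lsmul ℝ ℝ) (hρs.of_le (by simp)) hFL (c • y)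
  have h2 : HasFDerivAt (fun y : Eu n => c • y) (c • ContinuousLinearMap.id ℝ (Eu n)) y :=
    (hasFDerivAt_id y).const_smul c
  have h3 : partialDeriv i (dilMollify k F) y =
      c * ((fderiv ℝ ρ ⋆[(lsmul ℝ ℝ : ℝ →L[ℝ] ℝ →L[ℝ] ℝ).precompL (Eu n), volume] F) (c • y)) e := by
    rw [partialDeriv, show dilMollify k F = (ρ ⋆[lsmul ℝ ℝ, volume] F) ∘ fun y => c • y from rfl,
      (h1.comp y h2).fderiv]
    simp [he]
  have hex : ConvolutionExistsAt (fderiv ℝ ρ) F (c • y)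
      ((lsmul ℝ ℝ : ℝ →L[ℝ] ℝ →L[ℝ] ℝ).precompL (Eu n)) volume :=
    (hρc.fderiv ℝ).convolutionExists_left _ (hρs.continuous_fderiv (by simp)) hFL _
  have h4 : ((fderiv ℝ ρ ⋆[(lsmul ℝ ℝ : ℝ →L[ℝ] ℝ →L[ℝ] ℝ).precompL (Eu n), volume] F)
      (c • y)) e = ∫ w, fderiv ℝ ρ (c • y - w) e * F w := by
    rw [convolution_eq_swap, ContinuousLinearMap.integral_apply hex.integrable_swap]
    rfl
  -- The mollifier, translated to a point of the smaller ball, is a test function on the unit ball.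
  set ψ : Eu n → ℝ := fun w => ρ (c • y - w) with hψ
  have hψt : IsTest (unitBall n) ψ := by
    have hsub : tsupport ψ ⊆ closedBall (c • y) (mollRadius k) := by
      refine closure_minimal (fun w hw => ?_) isClosed_closedBall
      have hw' : c • y - w ∈ Function.support ρ := hw
      rw [hρ, (mollBump n k).support_normed_eq, mem_ball_zero_iff] at hw'
      rw [mem_closedBall, dist_comm, dist_eq_norm]
      exact hw'.le
    refine ⟨hρs.comp (contDiff_const.sub contDiff_id), ?_, fun w hw => ?_⟩
    · exact (isCompact_closedBall _ _).of_isClosed_subset (isClosed_tsupport _) hsub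
    · have hw1 : ‖w - c • y‖ ≤ mollRadius k := by simpa [dist_eq_norm] using hsub hw
      have hy1 : ‖y‖ < 1 := by simpa [unitBall] using hy
      have hc0 : 0 < c := by linarith [mollRadius_le k]
      have hcy : ‖c • y‖ < c := by
        rw [norm_smul, Real.norm_of_nonneg hc0.le]
        nlinarith
      simp only [unitBall, mem_ball_zero_iff]
      have := norm_add_le (w - c • y) (c • y)
      rw [sub_add_cancel] at this
      linarith [mollRadius_pos k]
  have hψd : ∀ w, partialDeriv i ψ w = -fderiv ℝ ρ (c • y - w) e := by
    intro w
    have h5 : HasFDerivAt (fun w : Eu n => c • y - w) (-ContinuousLinearMap.id ℝ (Eu n)) w :=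
      (hasFDerivAt_id w).const_sub (c • y)
    have h6 := ((hρs.differentiable (by simp) (c • y - w)).hasFDerivAt).comp w h5
    rw [partialDeriv, show ψ = ρ ∘ fun w => c • y - w from rfl, h6.fderiv]
    simp [he]
  have hint : ∀ (b q : Eu n → ℝ), ∫ w, b w * (unitBall n).indicator q w =
      ∫ w in unitBall n, q w * b w := by
    intro b q
    rw [← integral_indicator measurableSet_unitBall]
    refine integral_congr_ae (Eventually.of_forall fun w => ?_)
    by_cases hw : w ∈ unitBall n
    · simp [hw, mul_comm]
    · simp [hw]
  have h7 := hd.2.2 ψ hψt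
  simp_rw [hψd] at h7
  rw [h3, h4, hint]
  have h8 : dilMollify k ((unitBall n).indicator d) y = ∫ w, ψ w * (unitBall n).indicator d w := by
    rw [dilMollify, convolution_eq_swap]
    rfl
  rw [h8, hint]
  simp only [mul_neg, integral_neg, neg_inj] at h7
  rw [h7]

/-- Functions smooth up to the sphere are dense in `W₂¹(B)`. -/
theorem MemW1.exists_tendstoW1 {f : Eu n → ℝ} (hf : MemW1 (unitBall n) f) :
    ∃ φ : ℕ → Eu n → ℝ, (∀ k, ContDiff ℝ ∞ (φ k)) ∧ TendstoW1 (unitBall n) φ f := by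
  have hind : ∀ {q : Eu n → ℝ}, MemLp q 2 (volume.restrict (unitBall n)) →
      MemLp ((unitBall n).indicator q) 2 := fun hq =>
    (memLp_indicator_iff_restrict measurableSet_unitBall).2 hq
  have hB : ∀ᵐ y ∂((volume : Measure (Eu n)).restrict (unitBall n)), y ∈ unitBall n :=
    ae_restrict_mem measurableSet_unitBall
  refine ⟨fun k => dilMollify k ((unitBall n).indicator f), fun k =>
    contDiff_dilMollify ((hind hf.1).locallyIntegrable (by norm_num)), ?_, fun i => ?_⟩
  · refine (tendsto_dilMollify (hind hf.1)).congr fun k => eLpNorm_congr_ae ?_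
    filter_upwards [hB] with y hy
    rw [Set.indicator_of_mem hy]
  · set d := weakPartial (unitBall n) i f with hd
    have hdL := hf.memLp_weakPartial isOpen_unitBall i
    set T : ℕ → Eu n → ℝ := fun k => dilMollify k ((unitBall n).indicator d) with hT
    have hTL : ∀ k, MemLp (T k) 2 (volume.restrict (unitBall n)) := fun k =>
      memLp_dilMollify (hind hdL)
    have hTt : Tendsto (fun k => eLpNorm (fun y => T k y - d y) 2 (volume.restrict (unitBall n)))
        atTop (𝓝 0) := by
      refine (tendsto_dilMollify (hind hdL)).congr fun k => eLpNorm_congr_ae ?_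
      filter_upwards [hB] with y hy
      rw [Set.indicator_of_mem hy]
    -- The dilation factor tends to one.
    have hbound : ∀ k, eLpNorm (fun y => partialDeriv i
        (dilMollify k ((unitBall n).indicator f)) y - d y) 2 (volume.restrict (unitBall n)) ≤
        eLpNorm (fun y => T k y - d y) 2 (volume.restrict (unitBall n)) +
          ENNReal.ofReal (2 * mollRadius k) * (ENNReal.ofReal (Real.sqrt (2 ^ n)) *
            eLpNorm ((unitBall n).indicator d) 2 volume) := by
      intro k
      have hk := mollRadius_pos k
      have e1 : eLpNorm (fun y => partialDeriv i
          (dilMollify k ((unitBall n).indicator f)) y - d y) 2 (volume.restrict (unitBall n)) =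
          eLpNorm ((fun y => T k y - d y) + (-(2 * mollRadius k)) • T k) 2
            (volume.restrict (unitBall n)) := by
        refine eLpNorm_congr_ae ?_
        filter_upwards [hB] with y hy
        rw [partialDeriv_dilMollify hf.1 (hf.hasWeakPartial i) hy]
        simp only [hT, Pi.add_apply, Pi.smul_apply, smul_eq_mul]
        ring
      rw [e1]
      refine (eLpNorm_add_le ((hTL k).sub hdL).1 ((hTL k).1.const_smul _) (by norm_num)).trans ?_
      refine add_le_add le_rfl ?_
      rw [eLpNorm_const_smul]
      gcongr
      · rw [enorm_neg, Real.enorm_of_nonneg (by positivity)]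
      · exact eLpNorm_dilMollify_le (hind hdL)
    refine tendsto_of_tendsto_of_tendsto_of_le_of_le tendsto_const_nhds ?_ (fun k => zero_le)
      hbound
    have h2 : Tendsto (fun k => ENNReal.ofReal (2 * mollRadius k)) atTop (𝓝 0) := by
      simpa using ENNReal.tendsto_ofReal (tendsto_mollRadius.const_mul 2)
    have h3 := ENNReal.Tendsto.mul_const (b := ENNReal.ofReal (Real.sqrt (2 ^ n)) *
      eLpNorm ((unitBall n).indicator d) 2 volume) h2
      (Or.inr (ENNReal.mul_ne_top ENNReal.ofReal_ne_top (hind hdL).eLpNorm_ne_top))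
    simpa using hTt.add h3

/-- Every function in `W₂¹(B)` has a trace on the sphere. -/
theorem MemW1.exists_isSphereTrace (hn : 1 ≤ n) {f : Eu n → ℝ} (hf : MemW1 (unitBall n) f) :
    ∃ τ, IsSphereTrace f τ := by
  obtain ⟨φ, hφ, hφf⟩ := hf.exists_tendstoW1
  have m0 : ∀ k, MemLp (φ k) 2 (volume.restrict (unitBall n)) := fun k =>
    memLp_of_continuousOn_closedBall (hφ k).continuous.continuousOn
  have m1 : ∀ k i, MemLp (partialDeriv i (φ k)) 2 (volume.restrict (unitBall n)) := fun k i =>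
    memLp_partialDeriv (hφ k).contDiffOn i
  have ms : ∀ k, MemLp (fun s : UnitSphere n => φ k s) 2 (surface n) := fun k =>
    memLp_surface_of_continuous (continuous_comp_sphere (hφ k).continuous.continuousOn)
  have sq : ∀ {p : ℕ → Eu n → ℝ} {q : Eu n → ℝ},
      (∀ k, MemLp (p k) 2 (volume.restrict (unitBall n))) →
      MemLp q 2 (volume.restrict (unitBall n)) →
      Tendsto (fun k => eLpNorm (fun y => p k y - q y) 2 (volume.restrict (unitBall n)))
        atTop (𝓝 0) →
      Tendsto (fun k => ∫ y in unitBall n, (p k y - q y) ^ 2) atTop (𝓝 0) := by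
    intro p q hp hq h
    have h' := tendsto_integral_sq (F := fun _ => 0) (fun k => (hp k).sub hq) (by simp)
      (by simpa using h)
    simpa using h'
  have t0 := sq m0 hf.1 hφf.1
  have t1 := fun i => sq (fun k => m1 k i) (hf.memLp_weakPartial isOpen_unitBall i) (hφf.2 i)
  set E : ℕ → ℝ := fun k => 2 * (n + 1) * (∫ y in unitBall n, (φ k y - f y) ^ 2) +
    4 * ∑ i, ∫ y in unitBall n, (partialDeriv i (φ k) y - weakPartial (unitBall n) i f y) ^ 2
    with hE
  have tE : Tendsto E atTop (𝓝 0) := by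
    have := (t0.const_mul (2 * ((n : ℝ) + 1))).add
      ((tendsto_finsetSum Finset.univ fun i _ => t1 i).const_mul 4)
    simpa using this
  have tri : ∀ {p q r : Eu n → ℝ}, MemLp p 2 (volume.restrict (unitBall n)) →
      MemLp q 2 (volume.restrict (unitBall n)) → MemLp r 2 (volume.restrict (unitBall n)) →
      ∫ y in unitBall n, (p y - q y) ^ 2 ≤
        2 * (∫ y in unitBall n, (p y - r y) ^ 2) + 2 * ∫ y in unitBall n, (q y - r y) ^ 2 := by
    intro p q r hp hq hr
    have i1 : Integrable (fun y => (p y - r y) ^ 2) (volume.restrict (unitBall n)) :=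
      (hp.sub hr).integrable_sq
    have i2 : Integrable (fun y => (q y - r y) ^ 2) (volume.restrict (unitBall n)) :=
      (hq.sub hr).integrable_sq
    rw [← integral_const_mul, ← integral_const_mul,
      ← integral_add (i1.const_mul 2) (i2.const_mul 2)]
    refine integral_mono (hp.sub hq).integrable_sq ((i1.const_mul 2).add (i2.const_mul 2))
      fun y => ?_
    simp only
    nlinarith [sq_nonneg (p y - r y + (q y - r y))]
  obtain ⟨τ, hτ, hφτ⟩ := exists_tendsto_eLpNorm_of_cauchy ms fun ε hε => by
    obtain ⟨N, hN⟩ := eventually_atTop.1 (tE.eventually_lt_const (half_pos hε))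
    refine ⟨N, fun k hk l hl => ?_⟩
    have h1 := (abs_le.1 (abs_integral_sphere_sq_sub_le_of_contDiff hn ((hφ k).sub (hφ l)))).2
    have hdp : ∀ i y, partialDeriv i (fun y => φ k y - φ l y) y =
        partialDeriv i (φ k) y - partialDeriv i (φ l) y := by
      intro i y
      rw [partialDeriv, fderiv_fun_sub ((hφ k).differentiable (by simp) y)
        ((hφ l).differentiable (by simp) y)]
      rfl
    simp only [hdp] at h1
    have h2 := tri (m0 k) (m0 l) hf.1
    have h3 := Finset.sum_le_sum fun i (_ : i ∈ Finset.univ) =>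
      tri (m1 k i) (m1 l i) (hf.memLp_weakPartial isOpen_unitBall i)
    rw [Finset.sum_add_distrib, ← Finset.mul_sum, ← Finset.mul_sum] at h3
    have h4 := hN k hk
    have h5 := hN l hl
    have h6 : 0 ≤ ∫ y in unitBall n, (φ k y - φ l y) ^ 2 := integral_nonneg fun y => sq_nonneg _
    have h7 := mul_le_mul_of_nonneg_left h2 (show (0 : ℝ) ≤ n + 1 by positivity)
    simp only [hE] at h4 h5
    nlinarith
  exact ⟨τ, hf, hτ, φ, hφ, hφf, hφτ⟩

theorem MemW1.isSphereTrace_sphereTrace (hn : 1 ≤ n) {f : Eu n → ℝ}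
    (hf : MemW1 (unitBall n) f) : IsSphereTrace f (sphereTrace f) := by
  have h := hf.exists_isSphereTrace hn
  rw [sphereTrace, dif_pos h]
  exact h.choose_spec

end Density

/-! ### Gram matrices -/

section Gram

open Matrix

/-- The Gram matrix `(A eᵢ | A eⱼ)` of a linear map. -/
noncomputable def gram (A : Eu n →L[ℝ] Eu n) : Matrix (Fin n) (Fin n) ℝ :=
  Matrix.of fun i j => inner ℝ (A (EuclideanSpace.single i 1)) (A (EuclideanSpace.single j 1))

theorem sum_smul_single (η : Fin n → ℝ) :
    ∑ j, η j • (EuclideanSpace.single j (1 : ℝ) : Eu n) = WithLp.toLp 2 η := by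
  ext i
  simp [Finset.sum_apply, Pi.single_apply]

theorem dotProduct_gram_mulVec (A : Eu n →L[ℝ] Eu n) (ξ η : Fin n → ℝ) :
    ξ ⬝ᵥ (gram A *ᵥ η) = inner ℝ (A (WithLp.toLp 2 ξ)) (A (WithLp.toLp 2 η)) := by
  rw [← sum_smul_single ξ, ← sum_smul_single η, map_sum, map_sum, sum_inner]
  refine Finset.sum_congr rfl fun i _ => ?_
  rw [inner_sum, mulVec, dotProduct, Finset.mul_sum]
  refine Finset.sum_congr rfl fun j _ => ?_
  rw [map_smul, map_smul, real_inner_smul_left, real_inner_smul_right, gram, Matrix.of_apply]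
  ring

theorem isHermitian_gram (A : Eu n →L[ℝ] Eu n) : (gram A).IsHermitian := by
  ext i j
  simp [gram, real_inner_comm]

variable {A : Eu n →L[ℝ] Eu n} {K L : ℝ}

theorem posDef_gram (hL : ∀ v, ‖v‖ ≤ L * ‖A v‖) : (gram A).PosDef := by
  refine PosDef.of_dotProduct_mulVec_pos (isHermitian_gram A) fun {η} hη => ?_
  rw [show star η = η from rfl, dotProduct_gram_mulVec, real_inner_self_eq_norm_sq]
  have h1 : A (WithLp.toLp 2 η) ≠ 0 := by
    intro h0
    have h2 := hL (WithLp.toLp 2 η)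
    rw [h0, norm_zero, mul_zero, norm_le_zero_iff] at h2
    exact hη (by simpa using h2)
  positivity

theorem gram_mulVec_inv (hL : ∀ v, ‖v‖ ≤ L * ‖A v‖) (ξ : Fin n → ℝ) :
    gram A *ᵥ ((gram A)⁻¹ *ᵥ ξ) = ξ := by
  rw [mulVec_mulVec, Matrix.mul_nonsing_inv _ (posDef_gram hL).det_pos.ne'.isUnit, one_mulVec]

/-- Ellipticity of the inverse Gram matrix. -/
theorem sum_sq_le_inv_gram (hK0 : 0 ≤ K) (hK : ∀ v, ‖A v‖ ≤ K * ‖v‖)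
    (hL : ∀ v, ‖v‖ ≤ L * ‖A v‖) (ξ : Fin n → ℝ) :
    ∑ i, ξ i ^ 2 ≤ K ^ 2 * (ξ ⬝ᵥ ((gram A)⁻¹ *ᵥ ξ)) := by
  set η := (gram A)⁻¹ *ᵥ ξ with hη
  have hGη : gram A *ᵥ η = ξ := gram_mulVec_inv hL ξ
  have e1 : ξ ⬝ᵥ η = ‖A (WithLp.toLp 2 η)‖ ^ 2 := by
    rw [← real_inner_self_eq_norm_sq, ← dotProduct_gram_mulVec, hGη, dotProduct_comm]
  have e2 : ∑ i, ξ i ^ 2 = ‖(WithLp.toLp 2 ξ : Eu n)‖ ^ 2 := by rw [norm_sq_eq_sum]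
  have e3 : ‖(WithLp.toLp 2 ξ : Eu n)‖ ^ 2 = inner ℝ (A (WithLp.toLp 2 ξ)) (A (WithLp.toLp 2 η)) := by
    rw [← dotProduct_gram_mulVec, hGη, ← e2, dotProduct]
    exact Finset.sum_congr rfl fun i _ => sq (ξ i)
  set a := ‖(WithLp.toLp 2 ξ : Eu n)‖
  set b := ‖A (WithLp.toLp 2 η)‖
  have h1 : a ^ 2 ≤ K * a * b := by
    rw [e3]
    exact (real_inner_le_norm _ _).trans (by gcongr; exact hK _)
  have ha : 0 ≤ a := norm_nonneg _
  have hb : 0 ≤ b := norm_nonneg _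
  have h2 : a ≤ K * b := by
    rcases ha.eq_or_lt with h | h
    · rw [← h]; positivity
    · exact le_of_mul_le_mul_left (by nlinarith) h
  rw [e2, e1]
  calc a ^ 2 ≤ (K * b) ^ 2 := by gcongr
    _ = K ^ 2 * b ^ 2 := by ring

theorem abs_inv_gram_le (hL : ∀ v, ‖v‖ ≤ L * ‖A v‖) (i j : Fin n) :
    |(gram A)⁻¹ i j| ≤ L ^ 2 := by
  set ξ : Fin n → ℝ := Pi.single j 1 with hξ
  set η := (gram A)⁻¹ *ᵥ ξ with hη
  have hij : (gram A)⁻¹ i j = η i := by rw [hη, hξ, mulVec_single_one, col_apply]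
  have hGη : gram A *ᵥ η = ξ := gram_mulVec_inv hL ξ
  set b := ‖(WithLp.toLp 2 η : Eu n)‖
  have hcomp : ∀ k, |η k| ≤ b := fun k => by
    have h := PiLp.norm_apply_le (WithLp.toLp 2 η : Eu n) k
    simpa using h
  have e1 : ‖A (WithLp.toLp 2 η)‖ ^ 2 = η j := by
    rw [← real_inner_self_eq_norm_sq, ← dotProduct_gram_mulVec, hGη, hξ, dotProduct_single_one]
  have h1 : b ^ 2 ≤ L ^ 2 * b := by
    calc b ^ 2 ≤ (L * ‖A (WithLp.toLp 2 η)‖) ^ 2 := by gcongr; exact hL _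
      _ = L ^ 2 * η j := by rw [mul_pow, e1]
      _ ≤ L ^ 2 * b := by gcongr; exact (le_abs_self _).trans (hcomp j)
  rw [hij]
  refine (hcomp i).trans ?_
  rcases (norm_nonneg (WithLp.toLp 2 η : Eu n)).eq_or_lt with h | h
  · rw [show b = 0 from h.symm]; positivity
  · exact le_of_mul_le_mul_right (by nlinarith) h

theorem abs_gram_le (hK0 : 0 ≤ K) (hK : ∀ v, ‖A v‖ ≤ K * ‖v‖) (i j : Fin n) :
    |gram A i j| ≤ K ^ 2 := by
  have h : ∀ i, ‖A (EuclideanSpace.single i 1)‖ ≤ K := fun i => by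
    simpa using hK (EuclideanSpace.single i 1)
  calc |gram A i j| ≤ ‖A (EuclideanSpace.single i 1)‖ * ‖A (EuclideanSpace.single j 1)‖ :=
        abs_real_inner_le_norm (A (EuclideanSpace.single i 1)) (A (EuclideanSpace.single j 1))
    _ ≤ K * K := by gcongr <;> exact h _
    _ = K ^ 2 := (sq K).symm

theorem abs_det_le {M : Matrix (Fin n) (Fin n) ℝ} {c : ℝ} (h : ∀ i j, |M i j| ≤ c) :
    |M.det| ≤ n.factorial * c ^ n := by
  have := Matrix.det_le (A := M) (abv := AbsoluteValue.abs) (x := c) h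
  simpa using this

theorem det_gram_le (hK0 : 0 ≤ K) (hK : ∀ v, ‖A v‖ ≤ K * ‖v‖) :
    (gram A).det ≤ n.factorial * (K ^ 2) ^ n :=
  (le_abs_self _).trans (abs_det_le (abs_gram_le hK0 hK))

theorem one_le_mul_det_gram (hL : ∀ v, ‖v‖ ≤ L * ‖A v‖) :
    1 ≤ n.factorial * (L ^ 2) ^ n * (gram A).det := by
  have hd := (posDef_gram hL).det_pos
  have h1 := (le_abs_self _).trans (abs_det_le (abs_inv_gram_le hL))
  rw [Matrix.det_nonsing_inv, Ring.inverse_eq_inv', inv_eq_one_div, div_le_iff₀ hd] at h1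
  exact h1

/-- The entries of the inverse, by Cramer's rule. -/
theorem inv_apply_eq (M : Matrix (Fin n) (Fin n) ℝ) (i j : Fin n) :
    M⁻¹ i j = M.det⁻¹ * (M.updateRow j (Pi.single i 1)).det := by
  rw [Matrix.inv_def, Ring.inverse_eq_inv', Matrix.smul_apply, adjugate_apply, smul_eq_mul]

theorem contDiffOn_det {s : Set (Eu n)} {M : Eu n → Matrix (Fin n) (Fin n) ℝ}
    (hM : ∀ i j, ContDiffOn ℝ ∞ (fun y => M y i j) s) : ContDiffOn ℝ ∞ (fun y => (M y).det) s := by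
  simp only [Matrix.det_apply']
  exact ContDiffOn.sum fun σ _ => contDiffOn_const.mul (contDiffOn_prod fun i _ => hM _ _)

theorem contDiffOn_inv_apply {s : Set (Eu n)} {M : Eu n → Matrix (Fin n) (Fin n) ℝ}
    (hM : ∀ i j, ContDiffOn ℝ ∞ (fun y => M y i j) s) (h0 : ∀ y ∈ s, (M y).det ≠ 0) (i j : Fin n) :
    ContDiffOn ℝ ∞ (fun y => (M y)⁻¹ i j) s := by
  simp only [inv_apply_eq]
  refine ((contDiffOn_det hM).inv h0).mul (contDiffOn_det fun k l => ?_)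
  by_cases hk : k = j
  · subst hk
    simp only [updateRow_self]
    exact contDiffOn_const
  · simp only [updateRow_ne hk]
    exact hM k l

theorem measurable_det {α : Type*} [MeasurableSpace α] {M : α → Matrix (Fin n) (Fin n) ℝ}
    (hM : ∀ i j, Measurable fun p => M p i j) : Measurable fun p => (M p).det := by
  simp only [Matrix.det_apply']
  exact Finset.measurable_sum _ fun σ _ =>
    measurable_const.mul (Finset.measurable_prod _ fun i _ => hM _ _)

theorem measurable_inv_apply {α : Type*} [MeasurableSpace α] {M : α → Matrix (Fin n) (Fin n) ℝ}
    (hM : ∀ i j, Measurable fun p => M p i j) (i j : Fin n) :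
    Measurable fun p => (M p)⁻¹ i j := by
  simp only [inv_apply_eq]
  refine (measurable_det hM).inv.mul (measurable_det fun k l => ?_)
  by_cases hk : k = j
  · subst hk
    simp only [updateRow_self]
    exact measurable_const
  · simp only [updateRow_ne hk]
    exact hM k l

end Gram

/-! ### The metric coefficients of the cells -/

section Cells

variable {Ω : Set (Eu n)} {Ψ : Eu n → Eu n → Eu n}

theorem metric_eq_gram (Ψ : Eu n → Eu n → Eu n) (x y : Eu n) :
    metric Ψ x y = gram (fderivWithin ℝ (Ψ x) (closedUnitBall n) y) := rfl

theorem uniqueDiffOn_closedUnitBall : UniqueDiffOn ℝ (closedUnitBall n) :=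
  uniqueDiffOn_convex (convex_closedBall 0 1)
    ⟨0, mem_interior_iff_mem_nhds.2 (closedBall_mem_nhds 0 one_pos)⟩

theorem fderivWithin_closedUnitBall_eq (f : Eu n → Eu n) {y : Eu n} (hy : y ∈ unitBall n) :
    fderivWithin ℝ f (closedUnitBall n) y = fderiv ℝ f y :=
  fderivWithin_of_mem_nhds (mem_of_superset (isOpen_ball.mem_nhds hy) ball_subset_closedBall)

theorem contDiffOn_fderivWithin_cell {ψ : Eu n → Eu n}
    (hψ : ContDiffOn ℝ ∞ ψ (closedUnitBall n)) :
    ContDiffOn ℝ ∞ (fderivWithin ℝ ψ (closedUnitBall n)) (closedUnitBall n) :=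
  hψ.fderivWithin uniqueDiffOn_closedUnitBall (by simp)

theorem dist_cellMap (Ψ : Eu n → Eu n → Eu n) (x y z : Eu n) :
    dist (cellMap Ψ (x, y)) (cellMap Ψ (x, z)) = dist (Ψ x y) (Ψ x z) := by
  simp [cellMap, Prod.dist_eq]

/-- The derivatives of the cell maps and their inverses are bounded up to the sphere, uniformly in
the macroscopic variable. -/
theorem IsCellGeometry.exists_fderivWithin_bounds (hΨ : IsCellGeometry Ω Ψ) :
    ∃ K L : ℝ, 0 < K ∧ 0 < L ∧ ∀ x ∈ Ω, ∀ y ∈ closedUnitBall n, ∀ v,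
      ‖fderivWithin ℝ (Ψ x) (closedUnitBall n) y v‖ ≤ K * ‖v‖ ∧
      ‖v‖ ≤ L * ‖fderivWithin ℝ (Ψ x) (closedUnitBall n) y v‖ := by
  obtain ⟨K, hK⟩ := hΨ.lipschitz
  obtain ⟨L, hL⟩ := hΨ.lipschitz_inv
  refine ⟨K + 1, L + 1, by positivity, by positivity, fun x hx y hy v => ?_⟩
  have hlip : ∀ y ∈ unitBall n, ∀ z ∈ unitBall n, ‖Ψ x y - Ψ x z‖ ≤ K * ‖y - z‖ := by
    intro y hy z hz
    have h := hK.dist_le_mul (x, y) ⟨hx, hy⟩ (x, z) ⟨hx, hz⟩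
    rw [dist_cellMap] at h
    simpa [Prod.dist_eq, dist_eq_norm] using h
  have hanti : ∀ y ∈ unitBall n, ∀ z ∈ unitBall n, ‖y - z‖ ≤ L * ‖Ψ x y - Ψ x z‖ := by
    intro y hy z hz
    have hy' : (x, y) ∈ Ω ×ˢ unitBall n := ⟨hx, hy⟩
    have hz' : (x, z) ∈ Ω ×ˢ unitBall n := ⟨hx, hz⟩
    have h := hL.dist_le_mul (cellMap Ψ (x, y)) ⟨hx, y, hy, rfl⟩ (cellMap Ψ (x, z)) ⟨hx, z, hz, rfl⟩
    rw [hΨ.injOn.leftInvOn_invFunOn hy', hΨ.injOn.leftInvOn_invFunOn hz', dist_cellMap] at h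
    simpa [Prod.dist_eq, dist_eq_norm] using h
  have hsm := (hΨ.diffeo x hx).contDiffOn
  -- The bounds hold at interior points, as limits of difference quotients.
  have hint : ∀ y ∈ unitBall n, ‖fderivWithin ℝ (Ψ x) (closedUnitBall n) y v‖ ≤ K * ‖v‖ ∧
      ‖v‖ ≤ L * ‖fderivWithin ℝ (Ψ x) (closedUnitBall n) y v‖ := by
    intro y hy
    have hnhds : closedUnitBall n ∈ 𝓝 y :=
      mem_of_superset (isOpen_ball.mem_nhds hy) ball_subset_closedBall
    have hd : DifferentiableAt ℝ (Ψ x) y := (hsm.contDiffAt hnhds).differentiableAt (by simp)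
    have ht := (hd.hasFDerivAt.hasLineDerivAt v).tendsto_slope_zero_right
    rw [fderivWithin_closedUnitBall_eq _ hy]
    have hmem : ∀ᶠ t : ℝ in 𝓝[>] 0, y + t • v ∈ unitBall n ∧ 0 < t := by
      refine Filter.Eventually.and (nhdsWithin_le_nhds ?_) self_mem_nhdsWithin
      have hc : ContinuousAt (fun t : ℝ => y + t • v) 0 := by fun_prop
      exact hc.eventually_mem (isOpen_ball.mem_nhds (by simpa [unitBall] using hy))
    have hq : ∀ t : ℝ, 0 < t → ‖v‖ = t⁻¹ * ‖y + t • v - y‖ := by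
      intro t ht
      rw [add_sub_cancel_left, norm_smul, Real.norm_of_nonneg ht.le]
      field_simp
    constructor
    · refine le_of_tendsto ht.norm ?_
      filter_upwards [hmem] with t ⟨h1, h2⟩
      rw [norm_smul, Real.norm_of_nonneg (by positivity), hq t h2, mul_left_comm]
      gcongr
      exact hlip _ h1 _ hy
    · refine ge_of_tendsto (ht.norm.const_mul (L : ℝ)) ?_
      filter_upwards [hmem] with t ⟨h1, h2⟩
      rw [norm_smul, Real.norm_of_nonneg (by positivity), hq t h2, mul_left_comm]
      gcongr
      exact hanti _ h1 _ hy
  have hcl : y ∈ closure (unitBall n) := by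
    rw [unitBall, closure_ball _ one_ne_zero]
    exact hy
  have hcont : ContinuousWithinAt
      (fun y => ‖fderivWithin ℝ (Ψ x) (closedUnitBall n) y v‖) (unitBall n) y := by
    have h := ((contDiffOn_fderivWithin_cell hsm).continuousOn.clm_apply
      (continuousOn_const (c := v))).norm
    exact (h y hy).mono ball_subset_closedBall
  have hv := norm_nonneg v
  have hA := norm_nonneg (fderivWithin ℝ (Ψ x) (closedUnitBall n) y v)
  have b1 := ContinuousWithinAt.closure_le hcl hcont (continuousWithinAt_const (b := K * ‖v‖))
    fun z hz => (hint z hz).1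
  have b2 := ContinuousWithinAt.closure_le hcl (continuousWithinAt_const (b := ‖v‖))
    (continuousWithinAt_const.mul hcont : ContinuousWithinAt (fun y => (L : ℝ) *
      ‖fderivWithin ℝ (Ψ x) (closedUnitBall n) y v‖) (unitBall n) y)
    fun z hz => (hint z hz).2
  exact ⟨by linarith, b2.trans (by simp only [Pi.mul_apply]; linarith)⟩

/-- Uniform bounds for the coefficients of the Laplace-Beltrami operators of the cells. -/
structure CoeffBounds (Ω : Set (Eu n)) (Ψ : Eu n → Eu n → Eu n) (c C : ℝ) : Prop where
  pos : 0 < c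
  le : c ≤ C
  le_sqrtDet : ∀ x ∈ Ω, ∀ y ∈ closedUnitBall n, c ≤ sqrtDet Ψ x y
  sqrtDet_le : ∀ x ∈ Ω, ∀ y ∈ closedUnitBall n, sqrtDet Ψ x y ≤ C
  abs_coeff_le : ∀ x ∈ Ω, ∀ y ∈ closedUnitBall n, ∀ i j, |coeff Ψ x i j y| ≤ C
  elliptic : ∀ x ∈ Ω, ∀ y ∈ closedUnitBall n, ∀ ξ : Fin n → ℝ,
    c * ∑ i, ξ i ^ 2 ≤ ∑ i, ∑ j, coeff Ψ x i j y * ξ i * ξ j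

theorem IsCellGeometry.exists_coeffBounds (hΨ : IsCellGeometry Ω Ψ) :
    ∃ c C, CoeffBounds Ω Ψ c C := by
  obtain ⟨K, L, hK0, hL0, hb⟩ := hΨ.exists_fderivWithin_bounds
  set a := Real.sqrt (1 / (n.factorial * (L ^ 2) ^ n)) with ha
  set b := Real.sqrt (n.factorial * (K ^ 2) ^ n) with hb'
  have hfac : (0 : ℝ) < n.factorial := by exact_mod_cast n.factorial_pos
  have ha0 : 0 < a := Real.sqrt_pos.2 (by positivity)
  have hb0 : 0 ≤ b := Real.sqrt_nonneg _
  have h1 : ∀ x ∈ Ω, ∀ y ∈ closedUnitBall n, a ≤ sqrtDet Ψ x y := fun x hx y hy => by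
    refine Real.sqrt_le_sqrt ?_
    rw [metric_eq_gram, div_le_iff₀ (by positivity), mul_comm]
    exact one_le_mul_det_gram fun v => (hb x hx y hy v).2
  have h2 : ∀ x ∈ Ω, ∀ y ∈ closedUnitBall n, sqrtDet Ψ x y ≤ b := fun x hx y hy =>
    Real.sqrt_le_sqrt (det_gram_le hK0.le fun v => (hb x hx y hy v).1)
  refine ⟨min a (a / K ^ 2), max a (b + b * L ^ 2), lt_min ha0 (by positivity),
    (min_le_left _ _).trans (le_max_left _ _), fun x hx y hy => (min_le_left _ _).trans
    (h1 x hx y hy), fun x hx y hy => (h2 x hx y hy).trans ?_, fun x hx y hy i j => ?_,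
    fun x hx y hy ξ => ?_⟩
  · refine le_trans ?_ (le_max_right _ _)
    have : 0 ≤ b * L ^ 2 := by positivity
    linarith
  · refine le_trans ?_ (le_max_right _ _)
    have h0 : 0 ≤ sqrtDet Ψ x y := Real.sqrt_nonneg _
    rw [coeff, abs_mul, abs_of_nonneg h0]
    have h3 : |(metric Ψ x y)⁻¹ i j| ≤ L ^ 2 := abs_inv_gram_le (fun v => (hb x hx y hy v).2) i j
    have h4 := mul_le_mul (h2 x hx y hy) h3 (abs_nonneg _) hb0
    linarith
  · have h3 := sum_sq_le_inv_gram hK0.le (fun v => (hb x hx y hy v).1)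
      (fun v => (hb x hx y hy v).2) ξ
    rw [← metric_eq_gram] at h3
    have h4 : ∑ i, ∑ j, coeff Ψ x i j y * ξ i * ξ j =
        sqrtDet Ψ x y * (ξ ⬝ᵥ (Matrix.mulVec (metric Ψ x y)⁻¹ ξ)) := by
      simp only [dotProduct, Matrix.mulVec, Finset.mul_sum, coeff]
      exact Finset.sum_congr rfl fun i _ => Finset.sum_congr rfl fun j _ => by ring
    have h0 := Finset.sum_nonneg fun i (_ : i ∈ Finset.univ) => sq_nonneg (ξ i)
    have h5 : 0 ≤ ξ ⬝ᵥ (Matrix.mulVec (metric Ψ x y)⁻¹ ξ) := by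
      have hK2 : 0 < K ^ 2 := by positivity
      exact nonneg_of_mul_nonneg_right (h0.trans h3) hK2
    rw [h4]
    calc min a (a / K ^ 2) * ∑ i, ξ i ^ 2 ≤ a / K ^ 2 * ∑ i, ξ i ^ 2 := by
          gcongr; exact min_le_right _ _
      _ ≤ a / K ^ 2 * (K ^ 2 * (ξ ⬝ᵥ (Matrix.mulVec (metric Ψ x y)⁻¹ ξ))) := by gcongr
      _ = a * (ξ ⬝ᵥ (Matrix.mulVec (metric Ψ x y)⁻¹ ξ)) := by field_simp
      _ ≤ _ := by gcongr; exact h1 x hx y hy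

theorem coeff_symm (Ψ : Eu n → Eu n → Eu n) (x : Eu n) (i j : Fin n) (y : Eu n) :
    coeff Ψ x i j y = coeff Ψ x j i y := by
  have h : (metric Ψ x y)⁻¹.IsHermitian := (isHermitian_gram _).inv
  rw [coeff, coeff, ← h.apply i j]
  rfl

theorem det_metric_pos {c C : ℝ} (hb : CoeffBounds Ω Ψ c C) {x : Eu n} (hx : x ∈ Ω) {y : Eu n}
    (hy : y ∈ closedUnitBall n) : 0 < (metric Ψ x y).det :=
  Real.sqrt_pos.1 (hb.pos.trans_le (hb.le_sqrtDet x hx y hy))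

theorem contDiffOn_metric (hΨ : IsCellGeometry Ω Ψ) {x : Eu n} (hx : x ∈ Ω) (i j : Fin n) :
    ContDiffOn ℝ ∞ (fun y => metric Ψ x y i j) (closedUnitBall n) := by
  have h : ∀ i, ContDiffOn ℝ ∞ (cellPartial Ψ x i) (closedUnitBall n) := fun i =>
    (contDiffOn_fderivWithin_cell (hΨ.diffeo x hx).contDiffOn).clm_apply contDiffOn_const
  exact (h i).inner ℝ (h j)

theorem contDiffOn_sqrtDet (hΨ : IsCellGeometry Ω Ψ) {c C : ℝ} (hb : CoeffBounds Ω Ψ c C)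
    {x : Eu n} (hx : x ∈ Ω) : ContDiffOn ℝ ∞ (sqrtDet Ψ x) (closedBall 0 1) :=
  (contDiffOn_det (contDiffOn_metric hΨ hx)).sqrt fun _ hy => (det_metric_pos hb hx hy).ne'

theorem contDiffOn_coeff (hΨ : IsCellGeometry Ω Ψ) {c C : ℝ} (hb : CoeffBounds Ω Ψ c C)
    {x : Eu n} (hx : x ∈ Ω) (i j : Fin n) : ContDiffOn ℝ ∞ (coeff Ψ x i j) (closedBall 0 1) :=
  (contDiffOn_sqrtDet hΨ hb hx).mul (contDiffOn_inv_apply (contDiffOn_metric hΨ hx)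
    (fun _ hy => (det_metric_pos hb hx hy).ne') i j)

/-- Joint measurability of the metric: the cell maps extend to a Lipschitz function of both
variables, whose partial derivatives are jointly measurable. -/
theorem IsCellGeometry.exists_measurable_metric (hΨ : IsCellGeometry Ω Ψ) :
    ∃ M : Eu n × Eu n → Matrix (Fin n) (Fin n) ℝ, (∀ i j, Measurable fun p => M p i j) ∧
      ∀ x ∈ Ω, ∀ y ∈ unitBall n, metric Ψ x y = M (x, y) := by
  obtain ⟨K, hK⟩ := hΨ.lipschitz
  have h2 : LipschitzOnWith K (fun p : Eu n × Eu n => Ψ p.1 p.2) (Ω ×ˢ unitBall n) := by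
    refine LipschitzOnWith.of_dist_le_mul fun p hp q hq => ?_
    exact (le_max_right _ _).trans (hK.dist_le_mul p hp q hq)
  obtain ⟨G, hG, hΨG⟩ := h2.extend_finite_dimension
  set D : Eu n × Eu n → Eu n →L[ℝ] Eu n := fun p => fderiv ℝ (fun y => G (p.1, y)) p.2 with hD
  have hDm : ∀ v, Measurable fun p => D p v := fun v =>
    measurable_fderiv_apply_const_with_param (f := fun x y => G (x, y)) ℝ hG.continuous v
  refine ⟨fun p => gram (D p), fun i j => (hDm _).inner (hDm _), fun x hx y hy => ?_⟩
  rw [metric_eq_gram, fderivWithin_closedUnitBall_eq _ hy, hD]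
  congr 1
  refine Filter.EventuallyEq.fderiv_eq ?_
  filter_upwards [isOpen_ball.mem_nhds hy] with z hz
  exact hΨG (show (x, z) ∈ Ω ×ˢ unitBall n from ⟨hx, hz⟩)

variable (Ω) in
/-- The product measure on `Ω × B`. -/
noncomputable abbrev cellMeasure : Measure (Eu n × Eu n) :=
  (volume.restrict Ω).prod (volume.restrict (unitBall n))

theorem ae_cellMeasure_mem (hΩ : IsOpen Ω) :
    ∀ᵐ p ∂(cellMeasure Ω), p.1 ∈ Ω ∧ p.2 ∈ unitBall n := by
  rw [cellMeasure, Measure.prod_restrict]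
  exact ae_restrict_mem (hΩ.measurableSet.prod measurableSet_unitBall)

theorem IsCellGeometry.exists_measurable_coeff (hΨ : IsCellGeometry Ω Ψ) (i j : Fin n) :
    ∃ b : Eu n × Eu n → ℝ, Measurable b ∧
      ∀ x ∈ Ω, ∀ y ∈ unitBall n, coeff Ψ x i j y = b (x, y) := by
  obtain ⟨M, hM, hΨM⟩ := hΨ.exists_measurable_metric
  refine ⟨fun p => Real.sqrt (M p).det * (M p)⁻¹ i j,
    (measurable_det hM).sqrt.mul (measurable_inv_apply hM i j), fun x hx y hy => ?_⟩
  rw [coeff, sqrtDet, hΨM x hx y hy]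

theorem aestronglyMeasurable_coeff (hΩ : IsOpen Ω) (hΨ : IsCellGeometry Ω Ψ) (i j : Fin n) :
    AEStronglyMeasurable (fun p : Eu n × Eu n => coeff Ψ p.1 i j p.2) (cellMeasure Ω) := by
  obtain ⟨b, hb, hΨb⟩ := hΨ.exists_measurable_coeff i j
  refine hb.aestronglyMeasurable.congr ?_
  filter_upwards [ae_cellMeasure_mem hΩ] with p hp
  exact (hΨb _ hp.1 _ hp.2).symm

theorem aestronglyMeasurable_sqrtDet (hΩ : IsOpen Ω) (hΨ : IsCellGeometry Ω Ψ) :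
    AEStronglyMeasurable (fun p : Eu n × Eu n => sqrtDet Ψ p.1 p.2) (cellMeasure Ω) := by
  obtain ⟨M, hM, hΨM⟩ := hΨ.exists_measurable_metric
  refine (measurable_det hM).sqrt.aestronglyMeasurable.congr ?_
  filter_upwards [ae_cellMeasure_mem hΩ] with p hp
  rw [sqrtDet, hΨM _ hp.1 _ hp.2]

/-- The derivatives of the coefficients are jointly measurable, as limits of difference
quotients. -/
theorem aestronglyMeasurable_partialDeriv_coeff (hΩ : IsOpen Ω) (hΨ : IsCellGeometry Ω Ψ)
    {c C : ℝ} (hbd : CoeffBounds Ω Ψ c C) (k i j : Fin n) :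
    AEStronglyMeasurable (fun p : Eu n × Eu n => partialDeriv k (coeff Ψ p.1 i j) p.2)
      (cellMeasure Ω) := by
  obtain ⟨b, hb, hΨb⟩ := hΨ.exists_measurable_coeff i j
  set e : Eu n := EuclideanSpace.single k 1 with he
  set t : ℕ → ℝ := fun m => 1 / ((m : ℝ) + 1) with ht
  have ht0 : Tendsto t atTop (𝓝 0) := tendsto_one_div_add_atTop_nhds_zero_nat
  have htp : ∀ m, 0 < t m := fun m => by positivity
  refine AEMeasurable.aestronglyMeasurable (aemeasurable_of_tendsto_metrizable_ae atTop
    (f := fun m p => (t m)⁻¹ * (b (p.1, p.2 + t m • e) - b p)) (fun m => ?_) ?_)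
  · refine Measurable.aemeasurable (measurable_const.mul ((hb.comp ?_).sub hb))
    exact measurable_fst.prodMk (measurable_snd.add measurable_const)
  · filter_upwards [ae_cellMeasure_mem hΩ] with ⟨x, y⟩ ⟨hx, hy⟩
    simp only at hx hy ⊢
    have hd := differentiableAt_of_contDiffOn_closedBall (contDiffOn_coeff hΨ hbd hx i j) hy
    have hs := (hd.hasFDerivAt.hasLineDerivAt e).tendsto_slope_zero_right
    have hs' := hs.comp (tendsto_nhdsWithin_iff.2 ⟨ht0, Eventually.of_forall htp⟩)
    refine hs'.congr' ?_
    have hc : Tendsto (fun m => y + t m • e) atTop (𝓝 y) := by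
      simpa using (ht0.smul_const e).const_add y
    filter_upwards [hc.eventually_mem (isOpen_ball.mem_nhds hy)] with m hm
    simp only [Function.comp, smul_eq_mul]
    rw [hΨb x hx _ hm, hΨb x hx _ hy]

end Cells

/-! ### The macroscopic domain -/

section Macro

variable {Ω : Set (Eu n)} {u : Eu n → ℝ}

/-- Poincaré's inequality for test functions, from the divergence of the vector field `φ² y`. -/
theorem integral_sq_le_of_isTest (hn : 1 ≤ n) (hΩ : IsOpen Ω) {R : ℝ} (hR : ∀ x ∈ Ω, ‖x‖ ≤ R)
    {φ : Eu n → ℝ} (hφ : IsTest Ω φ) :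
    ∫ x in Ω, φ x ^ 2 ≤ 4 * R ^ 2 * ∑ i, ∫ x in Ω, partialDeriv i φ x ^ 2 := by
  have m0 := hφ.memLp
  have m1 := fun i => (hφ.partialDeriv i).memLp
  have t2 : ∀ i, IsTest Ω fun y => y i * φ y := fun i =>
    hφ.mul_contDiffOn hΩ (contDiff_coord i).contDiffOn
  have m2 := fun i => (t2 i).memLp
  have hwhole : ∀ {f g : Eu n → ℝ}, IsTest Ω f → IsTest Ω g → Integrable fun y => f y * g y :=
    fun hf hg => (hf.continuous.mul hg.continuous).integrable_of_hasCompactSupport hf.2.1.mul_right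
  have hset : ∀ {f g : Eu n → ℝ}, IsTest Ω f → ∫ y, f y * g y = ∫ y in Ω, f y * g y :=
    fun hf => (setIntegral_eq_integral_of_forall_compl_eq_zero fun y hy => by
      rw [hf.eq_zero hy, zero_mul]).symm
  have e1 : ∀ i, ∫ x in Ω, φ x ^ 2 = -(2 * ∫ x in Ω, φ x * x i * partialDeriv i φ x) := by
    intro i
    have e : ∫ y, y i * φ y * partialDeriv i φ y =
        -∫ y, partialDeriv i (fun y => y i * φ y) y * φ y :=
      integral_mul_fderiv_eq_neg_fderiv_mul_of_integrable (hwhole ((t2 i).partialDeriv i) hφ)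
        (hwhole (t2 i) (hφ.partialDeriv i)) (hwhole (t2 i) hφ)
        (fun x _ => (t2 i).1.differentiable (by simp) x) (fun x _ => hφ.1.differentiable (by simp) x)
    rw [hset (t2 i), hset ((t2 i).partialDeriv i)] at e
    have e2 : ∫ y in Ω, partialDeriv i (fun y => y i * φ y) y * φ y =
        (∫ y in Ω, φ y ^ 2) + ∫ y in Ω, y i * φ y * partialDeriv i φ y := by
      rw [← integral_add m0.integrable_sq (integrable_mul_of_memLp_two (m2 i) (m1 i))]
      refine integral_congr_ae (Eventually.of_forall fun y => ?_)
      simp only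
      rw [partialDeriv_mul ((contDiff_coord i).differentiable (by simp) y)
        (hφ.1.differentiable (by simp) y), partialDeriv_coord]
      ring
    have e3 : ∫ x in Ω, φ x * x i * partialDeriv i φ x =
        ∫ x in Ω, x i * φ x * partialDeriv i φ x :=
      integral_congr_ae (Eventually.of_forall fun y => by simp only; ring)
    rw [e3]
    linarith
  have i3 : ∀ i ∈ Finset.univ, Integrable (fun x => φ x * x i * partialDeriv i φ x)
      (volume.restrict Ω) := fun i _ =>
    (integrable_mul_of_memLp_two (m2 i) (m1 i)).congr (Eventually.of_forall fun x => by
      simp only; ring)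
  have e4 : n * ∫ x in Ω, φ x ^ 2 = -∫ x in Ω, 2 * ∑ i, φ x * x i * partialDeriv i φ x := by
    rw [integral_const_mul, integral_finsetSum _ i3, Finset.mul_sum, ← Finset.sum_neg_distrib,
      ← Finset.sum_congr rfl fun i _ => e1 i]
    simp
  have i5 : Integrable (fun x => 1 / 2 * φ x ^ 2 + 2 * R ^ 2 * ∑ i, partialDeriv i φ x ^ 2)
      (volume.restrict Ω) :=
    (m0.integrable_sq.const_mul _).add
      ((integrable_finsetSum _ fun i _ => (m1 i).integrable_sq).const_mul _)
  have h1 : -∫ x in Ω, 2 * ∑ i, φ x * x i * partialDeriv i φ x ≤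
      ∫ x in Ω, (1 / 2 * φ x ^ 2 + 2 * R ^ 2 * ∑ i, partialDeriv i φ x ^ 2) := by
    rw [← integral_neg]
    refine integral_mono_ae ((integrable_finsetSum _ i3).const_mul 2).neg i5 ?_
    filter_upwards [ae_restrict_mem hΩ.measurableSet] with x hx
    exact (neg_le_abs _).trans (two_mul_sum_le _ _ (hR x hx))
  rw [← e4, integral_add (m0.integrable_sq.const_mul _)
    ((integrable_finsetSum _ fun i _ => (m1 i).integrable_sq).const_mul _), integral_const_mul,
    integral_const_mul, integral_finsetSum _ fun i _ => (m1 i).integrable_sq] at h1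
  have h2 : 0 ≤ ∫ x in Ω, φ x ^ 2 := integral_nonneg fun y => sq_nonneg _
  have h3 : (1 : ℝ) ≤ n := by exact_mod_cast hn
  have h4 := mul_le_mul_of_nonneg_right h3 h2
  linarith

/-- Poincaré's inequality on `W₂^{1,0}(Ω)`. -/
theorem MemW10.integral_sq_le (hn : 1 ≤ n) (hΩ : IsOpen Ω) {R : ℝ} (hR : ∀ x ∈ Ω, ‖x‖ ≤ R)
    (hu : MemW10 Ω u) :
    ∫ x in Ω, u x ^ 2 ≤ 4 * R ^ 2 * ∑ i, ∫ x in Ω, weakPartial Ω i u x ^ 2 := by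
  obtain ⟨hu1, φ, hφ, hφu⟩ := hu
  have t0 := tendsto_integral_sq (fun k => (hφ k).memLp) hu1.1 hφu.1
  have t1 := fun i => tendsto_integral_sq (fun k => ((hφ k).partialDeriv i).memLp)
    (hu1.memLp_weakPartial hΩ i) (hφu.2 i)
  exact le_of_tendsto_of_tendsto' t0 ((tendsto_finsetSum _ fun i _ => t1 i).const_mul _)
    fun k => integral_sq_le_of_isTest hn hΩ hR (hφ k)

theorem MemW2.memLp_weakLaplacian (hΩ : IsOpen Ω) (hu : MemW2 Ω u) :
    MemLp (weakLaplacian Ω u) 2 (volume.restrict Ω) :=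
  memLp_finsetSum _ fun i _ => (hu.memW1_weakPartial hΩ i).memLp_weakPartial hΩ i

/-- Integration by parts for the Laplace operator with Dirichlet boundary condition. -/
theorem integral_weakLaplacian_mul (hΩ : IsOpen Ω) (hu2 : MemW2 Ω u) (hu : MemW10 Ω u) :
    ∫ x in Ω, weakLaplacian Ω u x * u x = -∑ i, ∫ x in Ω, weakPartial Ω i u x ^ 2 := by
  obtain ⟨hu1, φ, hφ, hφu⟩ := hu
  have m1 := fun i => hu1.memLp_weakPartial hΩ i
  have m2 := fun i => (hu2.memW1_weakPartial hΩ i).memLp_weakPartial hΩ i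
  have e : ∀ i, ∫ x in Ω, weakPartial Ω i (weakPartial Ω i u) x * u x =
      -∫ x in Ω, weakPartial Ω i u x ^ 2 := by
    intro i
    have t0 := tendsto_integral_mul_left (fun k => (hφ k).memLp) hu1.1 (m2 i) hφu.1
    have t1 := tendsto_integral_mul_left (fun k => ((hφ k).partialDeriv i).memLp) (m1 i) (m1 i)
      (hφu.2 i)
    have h := tendsto_nhds_unique t1 (t0.neg.congr fun k => ?_)
    · simp only [sq]
      rw [h, neg_neg]
      exact integral_congr_ae (Eventually.of_forall fun x => mul_comm _ _)
    · have h := ((hu2.memW1_weakPartial hΩ i).hasWeakPartial i).2.2 (φ k) (hφ k)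
      simp only [mul_comm (φ k _), mul_comm (partialDeriv i (φ k) _)]
      exact h.symm
  simp only [weakLaplacian, Finset.sum_mul]
  rw [integral_finsetSum _ fun i _ => integrable_mul_of_memLp_two (m2 i) hu1.1,
    ← Finset.sum_neg_distrib]
  exact Finset.sum_congr rfl fun i _ => e i

end Macro

/-! ### The cell problem at a fixed macroscopic point -/

section Cell

variable {Ω : Set (Eu n)} {Ψ : Eu n → Eu n → Eu n} {c C : ℝ} {x : Eu n} {v : Eu n → ℝ} {γ : ℝ}

/-- The Laplace-Beltrami operator in divergence form, with the product rule carried out. -/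
theorem sqrtDet_mul_laplaceBeltrami_ae_eq (hΨ : IsCellGeometry Ω Ψ) (hb : CoeffBounds Ω Ψ c C)
    (hx : x ∈ Ω) (hD : ∀ i, MemW1 (unitBall n) (weakPartial (unitBall n) i v)) :
    (fun y => sqrtDet Ψ x y * laplaceBeltrami Ψ x v y) =ᵐ[volume.restrict (unitBall n)]
      fun y => -∑ i, ∑ j, (partialDeriv i (coeff Ψ x i j) y * weakPartial (unitBall n) j v y +
        coeff Ψ x i j y * weakPartial (unitBall n) i (weakPartial (unitBall n) j v) y) := by
  have h : ∀ i j, _ =ᵐ[volume.restrict (unitBall n)] _ := fun i j =>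
    (((hD j).hasWeakPartial i).mul_contDiffOn isOpen_unitBall
      ((contDiffOn_coeff hΨ hb hx i j).mono ball_subset_closedBall)).weakPartial_ae_eq
      isOpen_unitBall
  have h' := ae_all_iff.2 fun i => ae_all_iff.2 fun j => h i j
  filter_upwards [h', ae_restrict_mem measurableSet_unitBall] with y hy hyB
  have h0 : sqrtDet Ψ x y ≠ 0 :=
    (hb.pos.trans_le (hb.le_sqrtDet x hx y (ball_subset_closedBall hyB))).ne'
  rw [laplaceBeltrami, ← mul_assoc, show sqrtDet Ψ x y * -(1 / sqrtDet Ψ x y) = -1 by field_simp,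
    neg_one_mul]
  simp only [hy]

theorem integrableOn_sqrtDet_mul_laplaceBeltrami (hΨ : IsCellGeometry Ω Ψ)
    (hb : CoeffBounds Ω Ψ c C) (hx : x ∈ Ω)
    (hD : ∀ i, MemW1 (unitBall n) (weakPartial (unitBall n) i v))
    (hv : MemLp v 2 (volume.restrict (unitBall n))) :
    IntegrableOn (fun y => sqrtDet Ψ x y * (laplaceBeltrami Ψ x v y * v y)) (unitBall n) := by
  have m : MemLp (fun y => ∑ i, ∑ j,
      (partialDeriv i (coeff Ψ x i j) y * weakPartial (unitBall n) j v y +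
        coeff Ψ x i j y * weakPartial (unitBall n) i (weakPartial (unitBall n) j v) y)) 2
      (volume.restrict (unitBall n)) :=
    memLp_finsetSum _ fun i _ => memLp_finsetSum _ fun j _ =>
      (memLp_partialDeriv_mul (contDiffOn_coeff hΨ hb hx i j) i (hD j).1).add
        (memLp_mul_of_continuousOn_closedBall (contDiffOn_coeff hΨ hb hx i j).continuousOn
          ((hD j).memLp_weakPartial isOpen_unitBall i))
  have m' := (memLp_congr_ae (sqrtDet_mul_laplaceBeltrami_ae_eq hΨ hb hx hD)).2 m.neg
  exact (integrable_mul_of_memLp_two m' hv).congr (Eventually.of_forall fun y => mul_assoc _ _ _)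

/-- The flux `∫_S ∑ √|g| g^{ij} ∂ᵢ v νⱼ ds`. -/
noncomputable def flux (Ψ : Eu n → Eu n → Eu n) (x : Eu n) (v : Eu n → ℝ) : ℝ :=
  ∑ i, ∑ j, ∫ s : UnitSphere n, coeff Ψ x i j s *
    sphereTrace (weakPartial (unitBall n) i v) s * (s : Eu n) j ∂(surface n)

theorem integrable_flux_integrand (hΨ : IsCellGeometry Ω Ψ) (hb : CoeffBounds Ω Ψ c C)
    (hx : x ∈ Ω) (i j : Fin n) {τ : UnitSphere n → ℝ} (hτ : MemLp τ 2 (surface n)) :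
    Integrable (fun s : UnitSphere n => coeff Ψ x i j s * τ s * (s : Eu n) j) (surface n) := by
  refine ((memLp_surface_mul_of_continuous (continuous_mul_coord_sphere
    (contDiffOn_coeff hΨ hb hx i j).continuousOn j) hτ).integrable (by norm_num)).congr
    (Eventually.of_forall fun s => ?_)
  simp only
  ring

theorem exchange_eq_neg_flux (hn : 1 ≤ n) (hΨ : IsCellGeometry Ω Ψ) (hb : CoeffBounds Ω Ψ c C)
    (hx : x ∈ Ω) {U : Eu n × Eu n → ℝ}
    (hD : ∀ i, MemW1 (unitBall n) (weakPartial (unitBall n) i (pullBack Ψ U x))) :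
    exchange Ψ U x = -flux Ψ x (pullBack Ψ U x) := by
  have hi := fun i j => integrable_flux_integrand hΨ hb hx i j
    ((hD i).isSphereTrace_sphereTrace hn).2.1
  rw [exchange, flux, integral_finsetSum _ fun i _ => integrable_finsetSum _ fun j _ => hi i j]
  simp_rw [integral_finsetSum _ fun j _ => hi _ j]

/-- The flux as a volume integral. -/
theorem flux_eq_integral (hn : 1 ≤ n) (hΨ : IsCellGeometry Ω Ψ) (hb : CoeffBounds Ω Ψ c C)
    (hx : x ∈ Ω) (hD : ∀ i, MemW1 (unitBall n) (weakPartial (unitBall n) i v)) :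
    flux Ψ x v = ∑ i, ∑ j, ((∫ y in unitBall n,
      partialDeriv j (coeff Ψ x i j) y * weakPartial (unitBall n) i v y) +
      ∫ y in unitBall n, coeff Ψ x i j y *
        weakPartial (unitBall n) j (weakPartial (unitBall n) i v) y) :=
  Finset.sum_congr rfl fun i _ => Finset.sum_congr rfl fun j _ =>
    (((hD i).isSphereTrace_sphereTrace hn).integral_mul hn (contDiffOn_coeff hΨ hb hx i j) j).symm

/-- The flux against the constant boundary value is controlled by the trace inequality. -/
theorem abs_mul_flux_le (hn : 1 ≤ n) (hΨ : IsCellGeometry Ω Ψ) (hb : CoeffBounds Ω Ψ c C)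
    (hx : x ∈ Ω) (hD : ∀ i, MemW1 (unitBall n) (weakPartial (unitBall n) i v)) (γ : ℝ) :
    |γ * flux Ψ x v| ≤ ∑ i, ∑ _j : Fin n, C * ((surface n).real Set.univ * γ ^ 2 +
      ((n + 1) * (∫ y in unitBall n, weakPartial (unitBall n) i v y ^ 2) +
        2 * ∑ k, ∫ y in unitBall n,
          weakPartial (unitBall n) k (weakPartial (unitBall n) i v) y ^ 2)) := by
  have hC : 0 ≤ C := hb.pos.le.trans hb.le
  rw [flux, Finset.mul_sum]
  refine (Finset.abs_sum_le_sum_abs _ _).trans (Finset.sum_le_sum fun i _ => ?_)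
  rw [Finset.mul_sum]
  refine (Finset.abs_sum_le_sum_abs _ _).trans (Finset.sum_le_sum fun j _ => ?_)
  have hT := (hD i).isSphereTrace_sphereTrace hn
  set τ := sphereTrace (weakPartial (unitBall n) i v)
  calc |γ * ∫ s : UnitSphere n, coeff Ψ x i j s * τ s * (s : Eu n) j ∂(surface n)|
      ≤ ∫ s : UnitSphere n, C * (γ ^ 2 + τ s ^ 2) ∂(surface n) := by
        rw [← integral_const_mul]
        refine abs_integral_le_integral_abs.trans (integral_mono
          ((integrable_flux_integrand hΨ hb hx i j hT.2.1).const_mul γ).abs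
          (((integrable_const _).add hT.2.1.integrable_sq).const_mul C) fun s => ?_)
        have h1 := hb.abs_coeff_le x hx s (sphere_subset_closedBall s.2) i j
        have h2 : |(s : Eu n) j| ≤ 1 := by
          have h := PiLp.norm_apply_le (s : Eu n) j
          rwa [norm_eq_of_mem_sphere] at h
        have h3 : |γ| * |τ s| ≤ γ ^ 2 + τ s ^ 2 := by
          nlinarith [sq_nonneg (|γ| - |τ s|), sq_abs γ, sq_abs (τ s), sq_nonneg γ,
            sq_nonneg (τ s)]
        simp only [abs_mul]
        calc |γ| * (|coeff Ψ x i j s| * |τ s| * |(s : Eu n) j|)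
            ≤ |γ| * (C * |τ s| * 1) := by gcongr
          _ = C * (|γ| * |τ s|) := by ring
          _ ≤ C * (γ ^ 2 + τ s ^ 2) := by gcongr
    _ = C * ((surface n).real Set.univ * γ ^ 2 + ∫ s, τ s ^ 2 ∂(surface n)) := by
        rw [integral_const_mul, integral_add (integrable_const _) hT.2.1.integrable_sq,
          integral_const, smul_eq_mul]
    _ ≤ _ := by
        gcongr
        exact hT.integral_sq_le hn

/-- Green's formula on a cell: the boundary term is the flux times the constant trace. -/
theorem integral_sqrtDet_mul_laplaceBeltrami (hn : 1 ≤ n) (hΨ : IsCellGeometry Ω Ψ)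
    (hb : CoeffBounds Ω Ψ c C) (hx : x ∈ Ω)
    (hD : ∀ i, MemW1 (unitBall n) (weakPartial (unitBall n) i v))
    (hv : IsSphereTrace v fun _ => γ) :
    ∫ y in unitBall n, sqrtDet Ψ x y * (laplaceBeltrami Ψ x v y * v y) =
      (∫ y in unitBall n, ∑ i, ∑ j, coeff Ψ x i j y * weakPartial (unitBall n) i v y *
        weakPartial (unitBall n) j v y) - γ * flux Ψ x v := by
  have ha := fun i j => contDiffOn_coeff hΨ hb hx i j
  set d := fun i => weakPartial (unitBall n) i v with hd
  have mD : ∀ i, MemLp (d i) 2 (volume.restrict (unitBall n)) := fun i => (hD i).1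
  have i1 : ∀ i j, Integrable (fun y => (partialDeriv i (coeff Ψ x i j) y * d j y +
      coeff Ψ x i j y * weakPartial (unitBall n) i (d j) y) * v y)
      (volume.restrict (unitBall n)) := fun i j =>
    integrable_mul_of_memLp_two ((memLp_partialDeriv_mul (ha i j) i (mD j)).add
      (memLp_mul_of_continuousOn_closedBall (ha i j).continuousOn
        ((hD j).memLp_weakPartial isOpen_unitBall i))) hv.1.1
  have i2 : ∀ i j, Integrable (fun y => coeff Ψ x i j y * d i y * d j y)
      (volume.restrict (unitBall n)) := fun i j =>
    integrable_mul_of_memLp_two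
      (memLp_mul_of_continuousOn_closedBall (ha i j).continuousOn (mD i)) (mD j)
  have e1 : ∫ y in unitBall n, sqrtDet Ψ x y * (laplaceBeltrami Ψ x v y * v y) =
      -∑ i, ∑ j, ∫ y in unitBall n, (partialDeriv i (coeff Ψ x i j) y * d j y +
        coeff Ψ x i j y * weakPartial (unitBall n) i (d j) y) * v y := by
    simp_rw [← integral_finsetSum _ fun j _ => i1 _ j]
    rw [← integral_finsetSum _ fun i _ => integrable_finsetSum _ fun j _ => i1 i j, ← integral_neg]
    refine integral_congr_ae ?_
    filter_upwards [sqrtDet_mul_laplaceBeltrami_ae_eq hΨ hb hx hD] with y hy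
    rw [← mul_assoc, hy, neg_mul, Finset.sum_mul]
    simp only [Finset.sum_mul, hd]
  have e2 : ∀ i j, ∫ y in unitBall n, (partialDeriv i (coeff Ψ x i j) y * d j y +
        coeff Ψ x i j y * weakPartial (unitBall n) i (d j) y) * v y =
      γ * (∫ s : UnitSphere n, coeff Ψ x j i s * sphereTrace (d j) s * (s : Eu n) i ∂(surface n)) -
        ∫ y in unitBall n, coeff Ψ x j i y * d j y * d i y := by
    intro i j
    have h := ((hD j).isSphereTrace_sphereTrace hn).integral_mul_of_const hn hv (ha i j) i
    simp only [coeff_symm Ψ x j i]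
    linarith
  have e3 : ∫ y in unitBall n, ∑ i, ∑ j, coeff Ψ x i j y * d i y * d j y =
      ∑ i, ∑ j, ∫ y in unitBall n, coeff Ψ x i j y * d i y * d j y := by
    rw [integral_finsetSum _ fun i _ => integrable_finsetSum _ fun j _ => i2 i j]
    simp_rw [integral_finsetSum _ fun j _ => i2 _ j]
  rw [e1, e3, flux]
  simp_rw [e2, Finset.sum_sub_distrib, ← Finset.mul_sum]
  rw [Finset.sum_comm (f := fun i j => ∫ s : UnitSphere n, coeff Ψ x j i s * sphereTrace (d j) s *
    (s : Eu n) i ∂(surface n)), Finset.sum_comm (f := fun i j =>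
    ∫ y in unitBall n, coeff Ψ x j i y * d j y * d i y)]
  ring

end Cell

/-! ### The two-scale problem -/

section TwoScale

variable {Ω : Set (Eu n)} {Ψ : Eu n → Eu n → Eu n} {c C : ℝ} {w : FunPair n}

theorem ae_memLp_two_section {f : Eu n × Eu n → ℝ} (hf : MemLp f 2 (cellMeasure Ω)) :
    ∀ᵐ x ∂(volume.restrict Ω), MemLp (fun y => f (x, y)) 2 (volume.restrict (unitBall n)) := by
  filter_upwards [hf.1.prodMk_left, hf.integrable_sq.prod_right_ae] with x hx hx2
  exact (memLp_two_iff_integrable_sq hx).2 hx2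

/-- At the point `x`, the cell function `V = Φ^* U` has weak derivatives up to order two in `L₂(B)`,
which are the sections at `x` of the jointly measurable `D` and `H`, and has the trace `u(x)`. -/
structure IsRegularAt (Ψ : Eu n → Eu n → Eu n) (w : FunPair n) (D : Fin n → Eu n × Eu n → ℝ)
    (H : Fin n → Fin n → Eu n × Eu n → ℝ) (x : Eu n) : Prop where
  memW1 : ∀ i, MemW1 (unitBall n) (weakPartial (unitBall n) i (pullBack Ψ w.2 x))
  fst_ae_eq : ∀ i, weakPartial (unitBall n) i (pullBack Ψ w.2 x)
    =ᵐ[volume.restrict (unitBall n)] fun y => D i (x, y)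
  snd_ae_eq : ∀ i j, weakPartial (unitBall n) j
    (weakPartial (unitBall n) i (pullBack Ψ w.2 x))
    =ᵐ[volume.restrict (unitBall n)] fun y => H i j (x, y)
  trace : IsSphereTrace (pullBack Ψ w.2 x) fun _ => w.1 x

theorem MemDom.exists_isRegularAt (hw : MemDom Ω Ψ w) :
    ∃ (D : Fin n → Eu n × Eu n → ℝ) (H : Fin n → Fin n → Eu n × Eu n → ℝ),
      (∀ i, MemLp (D i) 2 (cellMeasure Ω)) ∧ (∀ i j, MemLp (H i j) 2 (cellMeasure Ω)) ∧
      ∀ᵐ x ∂(volume.restrict Ω), IsRegularAt Ψ w D H x := by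
  obtain ⟨D, H, -, hD, hH, h⟩ := hw.memL2W2
  refine ⟨D, H, hD, hH, ?_⟩
  filter_upwards [h, hw.trace_eq, ae_all_iff.2 fun i => ae_memLp_two_section (hD i),
    ae_all_iff.2 fun i => ae_all_iff.2 fun j => ae_memLp_two_section (hH i j)] with x hx ht hDx hHx
  have e1 := fun i => (hx i).1.weakPartial_ae_eq isOpen_unitBall
  exact ⟨fun i => MemW1.congr ⟨hDx i, fun j => ⟨_, (hx i).2 j, hHx i j⟩⟩ (e1 i).symm, e1,
    fun i j => (((hx i).2 j).congr (e1 i).symm (ae_eq_refl _)).weakPartial_ae_eq isOpen_unitBall,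
    ht⟩

theorem pullBack_neg_opAq (hΨ : IsCellGeometry Ω Ψ) (w : FunPair n) {x : Eu n} (hx : x ∈ Ω)
    {y : Eu n} (hy : y ∈ unitBall n) :
    pullBack Ψ (-opAq Ω Ψ w).2 x y = -laplaceBeltrami Ψ x (pullBack Ψ w.2 x) y := by
  have h : cellInv Ψ x (Ψ x y) = y :=
    (hΨ.diffeo x hx).injOn.leftInvOn_invFunOn (ball_subset_closedBall hy)
  simp [pullBack, opAq, opA, pushForward, cellMap, h]

theorem neg_opAq_fst (w : FunPair n) (x : Eu n) :
    (-opAq Ω Ψ w).1 x = weakLaplacian Ω w.1 x + exchange Ψ w.2 x := by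
  simp [opAq, opA]
  ring

variable {D : Fin n → Eu n × Eu n → ℝ} {H : Fin n → Fin n → Eu n × Eu n → ℝ}

theorem IsRegularAt.integral_sq_fst {x : Eu n} (h : IsRegularAt Ψ w D H x) (i : Fin n) :
    ∫ y in unitBall n, weakPartial (unitBall n) i (pullBack Ψ w.2 x) y ^ 2 =
      ∫ y in unitBall n, D i (x, y) ^ 2 :=
  integral_congr_ae ((h.fst_ae_eq i).fun_comp (· ^ 2))

theorem IsRegularAt.integral_sq_snd {x : Eu n} (h : IsRegularAt Ψ w D H x) (i j : Fin n) :
    ∫ y in unitBall n,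
      weakPartial (unitBall n) j (weakPartial (unitBall n) i (pullBack Ψ w.2 x)) y ^ 2 =
      ∫ y in unitBall n, H i j (x, y) ^ 2 :=
  integral_congr_ae ((h.snd_ae_eq i j).fun_comp (· ^ 2))

/-- The exchange of mass, tested with `u`, is integrable over the macroscopic domain: the trace
inequality bounds it by the squares of all derivatives of the cell functions. -/
theorem integrable_mul_flux (hn : 1 ≤ n) (hΩ : IsOpen Ω) (hΨ : IsCellGeometry Ω Ψ)
    (hb : CoeffBounds Ω Ψ c C) (hu : MemLp w.1 2 (volume.restrict Ω))
    (hD : ∀ i, MemLp (D i) 2 (cellMeasure Ω)) (hH : ∀ i j, MemLp (H i j) 2 (cellMeasure Ω))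
    (h : ∀ᵐ x ∂(volume.restrict Ω), IsRegularAt Ψ w D H x) :
    Integrable (fun x => w.1 x * flux Ψ x (pullBack Ψ w.2 x)) (volume.restrict Ω) := by
  have hmeas : AEStronglyMeasurable (fun x => flux Ψ x (pullBack Ψ w.2 x))
      (volume.restrict Ω) := by
    have m : AEStronglyMeasurable (fun x => ∑ i, ∑ j,
        ((∫ y in unitBall n, partialDeriv j (coeff Ψ x i j) y * D i (x, y)) +
          ∫ y in unitBall n, coeff Ψ x i j y * H i j (x, y))) (volume.restrict Ω) := by
      refine Finset.aestronglyMeasurable_fun_sum _ fun i _ =>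
        Finset.aestronglyMeasurable_fun_sum _ fun j _ => ?_
      exact (((aestronglyMeasurable_partialDeriv_coeff hΩ hΨ hb j i j).mul
        (hD i).1).integral_prod_right').add
        (((aestronglyMeasurable_coeff hΩ hΨ i j).mul (hH i j).1).integral_prod_right')
    refine m.congr ?_
    filter_upwards [h, ae_restrict_mem hΩ.measurableSet] with x hx hxΩ
    rw [flux_eq_integral hn hΨ hb hxΩ hx.memW1]
    refine Finset.sum_congr rfl fun i _ => Finset.sum_congr rfl fun j _ => ?_
    congr 1
    · refine integral_congr_ae ?_
      filter_upwards [hx.fst_ae_eq i] with y hy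
      rw [hy]
    · refine integral_congr_ae ?_
      filter_upwards [hx.snd_ae_eq i j] with y hy
      rw [hy]
  have hbound : Integrable (fun x => ∑ i, ∑ _j : Fin n, C * ((surface n).real Set.univ *
      w.1 x ^ 2 + ((n + 1) * (∫ y in unitBall n, D i (x, y) ^ 2) +
        2 * ∑ k, ∫ y in unitBall n, H i k (x, y) ^ 2))) (volume.restrict Ω) := by
    refine integrable_finsetSum _ fun i _ => integrable_finsetSum _ fun _ _ => ?_
    exact ((hu.integrable_sq.const_mul _).add
      (((hD i).integrable_sq.integral_prod_left.const_mul _).add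
        ((integrable_finsetSum _ fun k _ =>
          (hH i k).integrable_sq.integral_prod_left).const_mul 2))).const_mul C
  refine hbound.mono' (hu.1.mul hmeas) ?_
  filter_upwards [h, ae_restrict_mem hΩ.measurableSet] with x hx hxΩ
  have h1 := abs_mul_flux_le hn hΨ hb hxΩ hx.memW1 (w.1 x)
  simp only [hx.integral_sq_fst, hx.integral_sq_snd] at h1
  exact h1

theorem integrable_energy (hΩ : IsOpen Ω) (hΨ : IsCellGeometry Ω Ψ) (hb : CoeffBounds Ω Ψ c C)
    (hD : ∀ i, MemLp (D i) 2 (cellMeasure Ω)) :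
    Integrable (fun p : Eu n × Eu n => ∑ i, ∑ j, coeff Ψ p.1 i j p.2 * D i p * D j p)
      (cellMeasure Ω) := by
  refine integrable_finsetSum _ fun i _ => integrable_finsetSum _ fun j _ =>
    integrable_mul_of_memLp_two (memLp_two_bdd_mul (C := C) (hD i)
      (aestronglyMeasurable_coeff hΩ hΨ i j) ?_) (hD j)
  filter_upwards [ae_cellMeasure_mem hΩ] with p hp
  exact hb.abs_coeff_le _ hp.1 _ (ball_subset_closedBall hp.2) i j

/-- Coercivity of the cell energies, by uniform ellipticity. -/
theorem le_integral_energy (hΩ : IsOpen Ω) (hΨ : IsCellGeometry Ω Ψ) (hb : CoeffBounds Ω Ψ c C)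
    (hD : ∀ i, MemLp (D i) 2 (cellMeasure Ω)) :
    c * ∫ x in Ω, ∑ i, ∫ y in unitBall n, D i (x, y) ^ 2 ≤
      ∫ x in Ω, ∫ y in unitBall n, ∑ i, ∑ j, coeff Ψ x i j y * D i (x, y) * D j (x, y) := by
  have hE := integrable_energy hΩ hΨ hb hD
  have hsq := fun i => (hD i).integrable_sq
  rw [← integral_const_mul]
  refine integral_mono_ae ((integrable_finsetSum _ fun i _ =>
    (hsq i).integral_prod_left).const_mul c) hE.integral_prod_left ?_
  filter_upwards [ae_restrict_mem hΩ.measurableSet, hE.prod_right_ae,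
    ae_all_iff.2 fun i => (hsq i).prod_right_ae] with x hx hEx hsx
  rw [← integral_finsetSum _ fun i _ => hsx i, ← integral_const_mul]
  refine integral_mono_ae ((integrable_finsetSum _ fun i _ => hsx i).const_mul c) hEx ?_
  filter_upwards [ae_restrict_mem measurableSet_unitBall] with y hy
  exact hb.elliptic x hx y (ball_subset_closedBall hy) fun i => D i (x, y)

theorem integrable_sqrtDet_mul (hΩ : IsOpen Ω) (hΨ : IsCellGeometry Ω Ψ)
    (hb : CoeffBounds Ω Ψ c C) {f : Eu n × Eu n → ℝ} (hf : MemLp f 2 (cellMeasure Ω)) :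
    Integrable (fun p : Eu n × Eu n => sqrtDet Ψ p.1 p.2 * (f p * f p)) (cellMeasure Ω) := by
  have h : MemLp (fun p : Eu n × Eu n => sqrtDet Ψ p.1 p.2 * f p) 2 (cellMeasure Ω) := by
    refine memLp_two_bdd_mul (C := C) hf (aestronglyMeasurable_sqrtDet hΩ hΨ) ?_
    filter_upwards [ae_cellMeasure_mem hΩ] with p hp
    rw [sqrtDet, abs_of_nonneg (Real.sqrt_nonneg _)]
    exact hb.sqrtDet_le _ hp.1 _ (ball_subset_closedBall hp.2)
  exact (integrable_mul_of_memLp_two h hf).congr (Eventually.of_forall fun p => mul_assoc _ _ _)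

theorem MemDom.innerYgExists_self (hΩ : IsOpen Ω) (hΨ : IsCellGeometry Ω Ψ)
    (hb : CoeffBounds Ω Ψ c C) (hw : MemDom Ω Ψ w) : InnerYgExists Ω Ψ w w := by
  obtain ⟨-, -, hV, -⟩ := hw.memL2W2
  have h := integrable_sqrtDet_mul hΩ hΨ hb hV
  exact ⟨integrable_mul_of_memLp_two hw.memW2.1 hw.memW2.1, h.prod_right_ae,
    h.integral_prod_left⟩

/-- Poincaré's inequality on the cells: the norm of `Y_g` is controlled by `u` and the gradients of
the cell functions. -/
theorem innerYg_self_le (hn : 1 ≤ n) (hΩ : IsOpen Ω) (hΨ : IsCellGeometry Ω Ψ)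
    (hb : CoeffBounds Ω Ψ c C) (hw : MemDom Ω Ψ w) (hD : ∀ i, MemLp (D i) 2 (cellMeasure Ω))
    (h : ∀ᵐ x ∂(volume.restrict Ω), IsRegularAt Ψ w D H x) :
    innerYg Ω Ψ w w ≤ (∫ x in Ω, w.1 x ^ 2) +
      C * (2 * (surface n).real Set.univ * (∫ x in Ω, w.1 x ^ 2) +
        4 * ∫ x in Ω, ∑ i, ∫ y in unitBall n, D i (x, y) ^ 2) := by
  have hC : 0 ≤ C := hb.pos.le.trans hb.le
  have i1 := hw.memW2.1.integrable_sq
  have i2 : Integrable (fun x => ∑ i, ∫ y in unitBall n, D i (x, y) ^ 2) (volume.restrict Ω) :=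
    integrable_finsetSum _ fun i _ => (hD i).integrable_sq.integral_prod_left
  have hex := hw.innerYgExists_self hΩ hΨ hb
  rw [innerYg]
  simp only [← sq]
  gcongr
  rw [← integral_const_mul, ← integral_const_mul, ← integral_add (i1.const_mul _) (i2.const_mul _),
    ← integral_const_mul]
  have hmi := hex.micro_integrable
  have hci := hex.cell_integrable
  simp only [← sq] at hmi hci
  refine integral_mono_ae hmi (((i1.const_mul _).add (i2.const_mul _)).const_mul C) ?_
  filter_upwards [h, ae_restrict_mem hΩ.measurableSet, hci] with x hx hxΩ hcx
  have h1 := hx.trace.integral_unitBall_sq_le hn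
  simp only [integral_const, smul_eq_mul, hx.integral_sq_fst] at h1
  have h2 : ∫ y in unitBall n, sqrtDet Ψ x y * pullBack Ψ w.2 x y ^ 2 ≤
      ∫ y in unitBall n, C * pullBack Ψ w.2 x y ^ 2 := by
    refine integral_mono_ae hcx (hx.trace.1.1.integrable_sq.const_mul C) ?_
    filter_upwards [ae_restrict_mem measurableSet_unitBall] with y hy
    exact mul_le_mul_of_nonneg_right (hb.sqrtDet_le x hxΩ y (ball_subset_closedBall hy))
      (sq_nonneg _)
  rw [integral_const_mul] at h2
  refine h2.trans (mul_le_mul_of_nonneg_left (h1.trans (le_of_eq ?_)) hC)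
  ring

/-- Green's formula on almost every cell. -/
theorem ae_integral_cell_neg_opAq (hn : 1 ≤ n) (hΩ : IsOpen Ω) (hΨ : IsCellGeometry Ω Ψ)
    (hb : CoeffBounds Ω Ψ c C) (h : ∀ᵐ x ∂(volume.restrict Ω), IsRegularAt Ψ w D H x) :
    (fun x => ∫ y in unitBall n, sqrtDet Ψ x y *
      (pullBack Ψ (-opAq Ω Ψ w).2 x y * pullBack Ψ w.2 x y)) =ᵐ[volume.restrict Ω]
    fun x => w.1 x * flux Ψ x (pullBack Ψ w.2 x) -
      ∫ y in unitBall n, ∑ i, ∑ j, coeff Ψ x i j y * D i (x, y) * D j (x, y) := by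
  filter_upwards [h, ae_restrict_mem hΩ.measurableSet] with x hx hxΩ
  have e1 : ∫ y in unitBall n, sqrtDet Ψ x y *
      (pullBack Ψ (-opAq Ω Ψ w).2 x y * pullBack Ψ w.2 x y) =
      -∫ y in unitBall n, sqrtDet Ψ x y *
        (laplaceBeltrami Ψ x (pullBack Ψ w.2 x) y * pullBack Ψ w.2 x y) := by
    rw [← integral_neg]
    refine integral_congr_ae ?_
    filter_upwards [ae_restrict_mem measurableSet_unitBall] with y hy
    rw [pullBack_neg_opAq hΨ w hxΩ hy]
    ring
  have e2 : ∫ y in unitBall n, ∑ i, ∑ j, coeff Ψ x i j y *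
        weakPartial (unitBall n) i (pullBack Ψ w.2 x) y *
        weakPartial (unitBall n) j (pullBack Ψ w.2 x) y =
      ∫ y in unitBall n, ∑ i, ∑ j, coeff Ψ x i j y * D i (x, y) * D j (x, y) := by
    refine integral_congr_ae ?_
    filter_upwards [ae_all_iff.2 hx.fst_ae_eq] with y hy
    simp only [hy]
  rw [e1, integral_sqrtDet_mul_laplaceBeltrami hn hΨ hb hxΩ hx.memW1 hx.trace, e2]
  ring

theorem ae_neg_opAq_fst_mul (hn : 1 ≤ n) (hΩ : IsOpen Ω) (hΨ : IsCellGeometry Ω Ψ)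
    (hb : CoeffBounds Ω Ψ c C) (h : ∀ᵐ x ∂(volume.restrict Ω), IsRegularAt Ψ w D H x) :
    (fun x => (-opAq Ω Ψ w).1 x * w.1 x) =ᵐ[volume.restrict Ω]
    fun x => weakLaplacian Ω w.1 x * w.1 x - w.1 x * flux Ψ x (pullBack Ψ w.2 x) := by
  filter_upwards [h, ae_restrict_mem hΩ.measurableSet] with x hx hxΩ
  rw [neg_opAq_fst, exchange_eq_neg_flux hn hΨ hb hxΩ hx.memW1]
  ring

theorem innerYgExists_neg_opAq (hn : 1 ≤ n) (hΩ : IsOpen Ω) (hΨ : IsCellGeometry Ω Ψ)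
    (hb : CoeffBounds Ω Ψ c C) (hw : MemDom Ω Ψ w) (hD : ∀ i, MemLp (D i) 2 (cellMeasure Ω))
    (hH : ∀ i j, MemLp (H i j) 2 (cellMeasure Ω))
    (h : ∀ᵐ x ∂(volume.restrict Ω), IsRegularAt Ψ w D H x) :
    InnerYgExists Ω Ψ (-opAq Ω Ψ w) w := by
  have hf := integrable_mul_flux hn hΩ hΨ hb hw.memW2.1 hD hH h
  refine ⟨?_, ?_, ?_⟩
  · exact ((integrable_mul_of_memLp_two (hw.memW2.memLp_weakLaplacian hΩ) hw.memW2.1).sub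
      hf).congr (ae_neg_opAq_fst_mul hn hΩ hΨ hb h).symm
  · filter_upwards [h, ae_restrict_mem hΩ.measurableSet] with x hx hxΩ
    refine (integrableOn_sqrtDet_mul_laplaceBeltrami hΨ hb hxΩ hx.memW1
      hx.trace.1.1).neg.congr ?_
    filter_upwards [ae_restrict_mem measurableSet_unitBall] with y hy
    simp only [Pi.neg_apply]
    rw [pullBack_neg_opAq hΨ w hxΩ hy]
    ring
  · exact (hf.sub (integrable_energy hΩ hΨ hb hD).integral_prod_left).congr
      (ae_integral_cell_neg_opAq hn hΩ hΨ hb h).symm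

/-- The energy identity: the exchange term and the boundary terms of the cells cancel. -/
theorem innerYg_neg_opAq (hn : 1 ≤ n) (hΩ : IsOpen Ω) (hΨ : IsCellGeometry Ω Ψ)
    (hb : CoeffBounds Ω Ψ c C) (hw : MemDom Ω Ψ w) (hD : ∀ i, MemLp (D i) 2 (cellMeasure Ω))
    (hH : ∀ i j, MemLp (H i j) 2 (cellMeasure Ω))
    (h : ∀ᵐ x ∂(volume.restrict Ω), IsRegularAt Ψ w D H x) :
    innerYg Ω Ψ (-opAq Ω Ψ w) w = -(∑ i, ∫ x in Ω, weakPartial Ω i w.1 x ^ 2) -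
      ∫ x in Ω, ∫ y in unitBall n, ∑ i, ∑ j, coeff Ψ x i j y * D i (x, y) * D j (x, y) := by
  have hf := integrable_mul_flux hn hΩ hΨ hb hw.memW2.1 hD hH h
  rw [innerYg, integral_congr_ae (ae_neg_opAq_fst_mul hn hΩ hΨ hb h),
    integral_congr_ae (ae_integral_cell_neg_opAq hn hΩ hΨ hb h),
    integral_sub (integrable_mul_of_memLp_two (hw.memW2.memLp_weakLaplacian hΩ) hw.memW2.1) hf,
    integral_sub hf (integrable_energy hΩ hΨ hb hD).integral_prod_left,
    integral_weakLaplacian_mul hΩ hw.memW2 hw.memW10]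
  ring

/-- Dissipativity with an explicit constant: its reciprocal `Q` satisfies
`((u, U), (u, U)) ≤ Q · (energy)` by Poincaré's inequalities. -/
theorem innerYg_neg_opAq_le (hn : 1 ≤ n) (hΩ : IsOpen Ω) {R : ℝ} (hR : ∀ x ∈ Ω, ‖x‖ ≤ R)
    (hΨ : IsCellGeometry Ω Ψ) (hb : CoeffBounds Ω Ψ c C) (hw : MemDom Ω Ψ w)
    (hD : ∀ i, MemLp (D i) 2 (cellMeasure Ω)) (hH : ∀ i j, MemLp (H i j) 2 (cellMeasure Ω))
    (h : ∀ᵐ x ∂(volume.restrict Ω), IsRegularAt Ψ w D H x) :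
    innerYg Ω Ψ (-opAq Ω Ψ w) w ≤ -(1 / ((1 + 2 * C * (surface n).real Set.univ) * (4 * R ^ 2) +
      4 * C / c)) * innerYg Ω Ψ w w := by
  have hc := hb.pos
  have hC : 0 < C := hc.trans_le hb.le
  set s := (surface n).real Set.univ
  have hs0 : 0 ≤ s := measureReal_nonneg
  set Q := (1 + 2 * C * s) * (4 * R ^ 2) + 4 * C / c with hQ
  have hQ0 : 0 < Q := by positivity
  have h1 := innerYg_self_le hn hΩ hΨ hb hw hD h
  have h2 := hw.memW10.integral_sq_le hn hΩ hR
  have h3 := le_integral_energy hΩ hΨ hb hD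
  rw [innerYg_neg_opAq hn hΩ hΨ hb hw hD hH h]
  set N := ∫ x in Ω, w.1 x ^ 2
  set E := ∑ i, ∫ x in Ω, weakPartial Ω i w.1 x ^ 2
  set P := ∫ x in Ω, ∑ i, ∫ y in unitBall n, D i (x, y) ^ 2
  set F := ∫ x in Ω, ∫ y in unitBall n, ∑ i, ∑ j, coeff Ψ x i j y * D i (x, y) * D j (x, y)
  have hE : 0 ≤ E := Finset.sum_nonneg fun i _ => integral_nonneg fun x => sq_nonneg _
  have hP : 0 ≤ P := integral_nonneg fun x => Finset.sum_nonneg fun i _ =>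
    integral_nonneg fun y => sq_nonneg _
  have hF : 0 ≤ F := (mul_nonneg hc.le hP).trans h3
  have key : innerYg Ω Ψ w w ≤ Q * (E + F) := by
    calc innerYg Ω Ψ w w ≤ (1 + 2 * C * s) * N + 4 * C / c * (c * P) := by
          refine h1.trans (le_of_eq ?_)
          field_simp
          ring
      _ ≤ (1 + 2 * C * s) * (4 * R ^ 2 * E) + 4 * C / c * F := by gcongr
      _ ≤ Q * (E + F) := by
          rw [hQ]
          have e1 : 0 ≤ (1 + 2 * C * s) * (4 * R ^ 2) * F := by positivity
          have e2 : 0 ≤ 4 * C / c * E := by positivity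
          linarith
  have h4 : 1 / Q * innerYg Ω Ψ w w ≤ E + F := by
    rw [one_div, inv_mul_le_iff₀ hQ0]
    exact key
  linarith

end TwoScale

end MatchedMicro

theorem mainTheorem6 {n : ℕ} (hn : 1 ≤ n) (Ω : Set (MatchedMicro.Eu n))
    (hΩ : MatchedMicro.IsSmoothBoundedDomain Ω)
    (Ψ : MatchedMicro.Eu n → MatchedMicro.Eu n → MatchedMicro.Eu n)
    (hΨ : MatchedMicro.IsCellGeometry Ω Ψ) :
    ∃ σ : ℝ, 0 < σ ∧ ∀ w : MatchedMicro.FunPair n, MatchedMicro.MemDom Ω Ψ w →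
      MatchedMicro.InnerYgExists Ω Ψ (-MatchedMicro.opAq Ω Ψ w) w ∧
      MatchedMicro.InnerYgExists Ω Ψ w w ∧
      MatchedMicro.innerYg Ω Ψ (-MatchedMicro.opAq Ω Ψ w) w
        ≤ -σ * MatchedMicro.innerYg Ω Ψ w w := by
  obtain ⟨c, C, hb⟩ := hΨ.exists_coeffBounds
  obtain ⟨R, -, hR⟩ := hΩ.isBounded.exists_pos_norm_le
  have hc := hb.pos
  have hC := hc.trans_le hb.le
  refine ⟨1 / ((1 + 2 * C * (MatchedMicro.surface n).real Set.univ) * (4 * R ^ 2) + 4 * C / c),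
    by positivity, fun w hw => ?_⟩
  obtain ⟨D, H, hD, hH, h⟩ := hw.exists_isRegularAt
  exact ⟨MatchedMicro.innerYgExists_neg_opAq hn hΩ.isOpen hΨ hb hw hD hH h,
    hw.innerYgExists_self hΩ.isOpen hΨ hb,
    MatchedMicro.innerYg_neg_opAq_le hn hΩ.isOpen hR hΨ hb hw hD hH h⟩
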